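/- Let $n,m,p,r\ge 0$ be integers, let $A\in\mathbb R^{n\times n}$ be symmetric positive definite, and let $B\in\mathbb R^{n\times m}$, $C\in\mathbb R^{p\times n}$. Let $\mathrm{Sym}(r)$ be the space of symmetric real $r\times r$ matrices, $\mathrm{Sym}_+(r)$ its open subset of positive definite matrices, and $$M=\mathrm{Sym}_+(r)\times\mathbb R^{r\times m}\times\mathbb R^{p\times r},$$ an open subset of $\mathrm{Sym}(r)\times\mathbb R^{r\times m}\times\mathbb R^{p\times r}$ (which is thus its tangent space at every point). Equip $M$ with $$\langle(\xi_1,\eta_1,\zeta_1),(\xi_2,\eta_2,\zeta_2)\rangle_{(A_r,B_r,C_r)}=\mathrm{tr}(A_r^{-1}\xi_1A_r^{-1}\xi_2)+\mathrm{tr}(\eta_1^T\eta_2)+\mathrm{tr}(\zeta_1^T\zeta_2),$$ which is a smooth Riemannian metric. For $(A_r,B_r,C_r)\in M$ let $$J(A_r,B_r,C_r)=\|G-G_r\|_{H^2}^2,\qquad G(s)=C(sI_n+A)^{-1}B,\quad G_r(s)=C_r(sI_r+A_r)^{-1}B_r,$$ where $\|H\|_{H^2}^2=\frac1{2\pi}\int_{-\infty}^{\infty}\mathrm{tr}\big(H(i\omega)^*H(i\omega)\big)\,d\omega$.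 This integral is finite for $H=G-G_r$, and $J$ is a smooth function on $M$. Write $\mathrm{sym}(S)=\frac12(S+S^T)$. Then, for every $x=(A_r,B_r,C_r)\in M$: 1. (Gradient.) The equations $$A_rP+PA_r-B_rB_r^T=0,\quad A_rQ+QA_r-C_r^TC_r=0,\quad AX+XA_r-BB_r^T=0,\quad AY+YA_r+C^TC_r=0$$ have a unique solution $(P,Q,X,Y)$, and the Riemannian gradient of $J$ is $$\mathrm{grad}\,J(A_r,B_r,C_r)=\big(-2A_r\,\mathrm{sym}(QP+Y^TX)\,A_r,\ 2(QB_r+Y^TB),\ 2(C_rP-CX)\big).$$ 2. (Hessian.) For every tangent vector $(A_r',B_r',C_r')\in\mathrm{Sym}(r)\times\mathbb R^{r\times m}\times\mathbb R^{p\times r}$ the equations $$A_rP'+P'A_r+A_r'P+PA_r'-B_r'B_r^T-B_rB_r'^T=0,$$ $$A_rQ'+Q'A_r+A_r'Q+QA_r'-C_r'^TC_r-C_r^TC_r'=0,$$ $$AX'+X'A_r+XA_r'-BB_r'^T=0,\qquad AY'+Y'A_r+YA_r'+C^TC_r'=0$$ have a unique solution $(P',Q',X',Y')$, the gradient field is differentiable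 at $x$, and the Riemannian Hessian of $J$ (the Levi-Civita covariant derivative of $\mathrm{grad}\,J$) is $$\mathrm{Hess}\,J(A_r,B_r,C_r)[(A_r',B_r',C_r')]=\big(-2A_r\,\mathrm{sym}(Q'P+QP'+Y'^TX+Y^TX')\,A_r-2\,\mathrm{sym}(A_r'\,\mathrm{sym}(QP+Y^TX)\,A_r),$$ $$2(Q'B_r+QB_r'+Y'^TB),\ 2(C_r'P+C_rP'-CX')\big).$$ 3. (Exponential map.) For every tangent vector $(\xi,\eta,\zeta)$ at $x$ the curve $$t\mapsto\big(A_r^{1/2}\exp(tA_r^{-1/2}\xi A_r^{-1/2})A_r^{1/2},\ B_r+t\eta,\ C_r+t\zeta\big),\qquad t\in\mathbb R,$$ is a geodesic of $M$ that starts at $x$ with velocity $(\xi,\eta,\zeta)$. The exponential map, i.e. the position at time $1$ of any geodesic on an open interval containing $0$ and $1$ that starts at $x$ with velocity $(\xi,\eta,\zeta)$, is well defined and $$\mathrm{Exp}_{(A_r,B_r,C_r)}(\xi,\eta,\zeta)=\big(A_r^{1/2}\exp(A_r^{-1/2}\xi A_r^{-1/2})A_r^{1/2},\ B_r+\eta,\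 C_r+\zeta\big).$$ Consequently $M$ is geodesically complete: the exponential map is defined for every tangent vector at every point. -/

import Mathlib

open Matrix Set MeasureTheory
open scoped ContDiff MatrixOrder Matrix.Norms.Frobenius

namespace ModelReduction

/-! ## Riemannian geometry on an open subset of a real vector space

Let `U` be an open subset of a real (finite-dimensional) normed space `E`. Then `U` is a manifold
with the single global chart `U ⊆ E`, and every tangent space `T_x U` is `E`. A metric on `U` is a
function `g : E → E → E → ℝ`, where `g x v w` is the inner product of `v` and `w` in `T_x U`; only
its values at points `x ∈ U` matter. -/

section Geometry

variable {E : Type*} [NormedAddCommGroup E] [NormedSpace ℝ E]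

/-- `g` is a smooth Riemannian metric on `U`. -/
structure IsRiemannianMetricOn (g : E → E → E → ℝ) (U : Set E) : Prop where
  smooth : ∀ v w, ContDiffOn ℝ ∞ (fun x => g x v w) U
  add_left : ∀ x ∈ U, ∀ v₁ v₂ w, g x (v₁ + v₂) w = g x v₁ w + g x v₂ w
  smul_left : ∀ x ∈ U, ∀ (a : ℝ) (v w : E), g x (a • v) w = a * g x v w
  symm : ∀ x ∈ U, ∀ v w, g x v w = g x w v
  pos : ∀ x ∈ U, ∀ v, v ≠ 0 → 0 < g x v v

/-- The tangent vector at `x` that represents the linear functional `ℓ`: the vector `v` with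
`⟨v, w⟩_x = ℓ w` for all tangent vectors `w`. -/
noncomputable def sharp (g : E → E → E → ℝ) (x : E) (ℓ : E → ℝ) : E :=
  Classical.epsilon fun v => ∀ w, g x v w = ℓ w

/-- The Riemannian gradient: `⟨grad f (x), ξ⟩_x = D f(x)[ξ]` for all tangent vectors `ξ`. -/
noncomputable def riemGrad (g : E → E → E → ℝ) (f : E → ℝ) (x : E) : E :=
  sharp g x fun ξ => fderiv ℝ f x ξ

/-- The Christoffel map `Γ_x(u, v)` of the Levi-Civita connection in the global chart, given by the
Koszul formula for constant vector fields,
`2 ⟨Γ_x(u, v), w⟩_x = D_u ⟨v, w⟩ + D_v ⟨u, w⟩ - D_w ⟨u, v⟩`. -/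
noncomputable def christoffel (g : E → E → E → ℝ) (x u v : E) : E :=
  sharp g x fun w =>
    (1 / 2) * (fderiv ℝ (fun y => g y v w) x u + fderiv ℝ (fun y => g y u w) x v
      - fderiv ℝ (fun y => g y u v) x w)

/-- The Levi-Civita covariant derivative `∇_ξ V` of the vector field `V` at `x`. -/
noncomputable def covDeriv (g : E → E → E → ℝ) (V : E → E) (x ξ : E) : E :=
  fderiv ℝ V x ξ + christoffel g x ξ (V x)

/-- The Riemannian Hessian `Hess f(x)[ξ] = ∇_ξ grad f`. -/
noncomputable def riemHess (g : E → E → E → ℝ) (f : E → ℝ) (x ξ : E) : E :=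
  covDeriv g (riemGrad g f) x ξ

/-- The curve `γ` is a geodesic of `(U, g)` on the open set `s` of times: it stays in `U` and solves
`γ'' + Γ_γ(γ', γ') = 0`, which is `∇_{γ'} γ' = 0`. -/
def IsGeodesicOn (g : E → E → E → ℝ) (U : Set E) (γ : ℝ → E) (s : Set ℝ) : Prop :=
  ∀ t ∈ s, γ t ∈ U ∧ DifferentiableAt ℝ γ t ∧
    HasDerivAt (deriv γ) (-christoffel g (γ t) (deriv γ t) (deriv γ t)) t

/-- `Exp_x(ξ)` is defined and has the value `y`: there is a geodesic on an open interval around `0`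
and `1` that starts at `x` with velocity `ξ` and is at `y` at time `1`. -/
def IsRiemExp (g : E → E → E → ℝ) (U : Set E) (x ξ y : E) : Prop :=
  ∃ s : Set ℝ, IsOpen s ∧ s.OrdConnected ∧ (0 : ℝ) ∈ s ∧ (1 : ℝ) ∈ s ∧
    ∃ γ : ℝ → E, IsGeodesicOn g U γ s ∧ γ 0 = x ∧ deriv γ 0 = ξ ∧ γ 1 = y

/-- `(U, g)` is geodesically complete: the exponential map is defined for every tangent vector at
every point. -/
def GeodesicallyComplete (g : E → E → E → ℝ) (U : Set E) : Prop :=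
  ∀ x ∈ U, ∀ ξ : E, ∃ y, IsRiemExp g U x ξ y

end Geometry

/-! ## Transfer functions and the `H²` norm -/

/-- The transfer function `G(s) = C (s I + A)⁻¹ B` of the system `x' = -A x + B u`, `y = C x`. -/
noncomputable def transferFunction {n m p : ℕ} (A : Matrix (Fin n) (Fin n) ℝ)
    (B : Matrix (Fin n) (Fin m) ℝ) (C : Matrix (Fin p) (Fin n) ℝ) (s : ℂ) :
    Matrix (Fin p) (Fin m) ℂ :=
  C.map Complex.ofReal * (s • (1 : Matrix (Fin n) (Fin n) ℂ) + A.map Complex.ofReal)⁻¹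
    * B.map Complex.ofReal

/-- The function `w ↦ tr (G(iw)ᴴ G(iw))`, the squared Frobenius norm of `G` along the imaginary
axis. -/
noncomputable def powerSpectrum {p m : ℕ} (G : ℂ → Matrix (Fin p) (Fin m) ℂ) (w : ℝ) : ℝ :=
  ((G (Complex.I * w))ᴴ * G (Complex.I * w)).trace.re

/-- The `H²` norm of a transfer function (of a stable system),
`‖G‖² = (1 / 2π) ∫ tr (G(iw)ᴴ G(iw)) dw`. -/
noncomputable def h2Norm {p m : ℕ} (G : ℂ → Matrix (Fin p) (Fin m) ℂ) : ℝ :=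
  Real.sqrt ((1 / (2 * Real.pi)) * ∫ w : ℝ, powerSpectrum G w)

/-! ## The manifold `M`, its metric, and the objective function -/

/-- The vector space of symmetric real `r × r` matrices. -/
def symMatrices (r : ℕ) : Submodule ℝ (Matrix (Fin r) (Fin r) ℝ) where
  carrier := {S | S.IsSymm}
  add_mem' hS hT := hS.add hT
  zero_mem' := Matrix.isSymm_zero
  smul_mem' a _ hS := hS.smul a

/-- The vector space `Sym(r) × ℝ^{r×m} × ℝ^{p×r}`. -/
abbrev Space (r m p : ℕ) : Type :=
  symMatrices r × Matrix (Fin r) (Fin m) ℝ × Matrix (Fin p) (Fin r) ℝ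

/-- The inclusion of `Space r m p` in the ambient space `ℝ^{r×r} × ℝ^{r×m} × ℝ^{p×r}`. -/
def ambient {r m p : ℕ} (x : Space r m p) :
    Matrix (Fin r) (Fin r) ℝ × Matrix (Fin r) (Fin m) ℝ × Matrix (Fin p) (Fin r) ℝ :=
  ((x.1 : Matrix (Fin r) (Fin r) ℝ), x.2.1, x.2.2)

/-- The manifold `M = Sym₊(r) × ℝ^{r×m} × ℝ^{p×r}`, an open subset of `Space r m p`. -/
def M (r m p : ℕ) : Set (Space r m p) :=
  {x | (x.1 : Matrix (Fin r) (Fin r) ℝ).PosDef}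

/-- The affine-invariant metric on the first factor, and the Euclidean metric on the others. -/
noncomputable def metric (r m p : ℕ) (x v w : Space r m p) : ℝ :=
  ((x.1 : Matrix (Fin r) (Fin r) ℝ)⁻¹ * (v.1 : Matrix (Fin r) (Fin r) ℝ)
      * (x.1 : Matrix (Fin r) (Fin r) ℝ)⁻¹ * (w.1 : Matrix (Fin r) (Fin r) ℝ)).trace
    + (v.2.1ᵀ * w.2.1).trace + (v.2.2ᵀ * w.2.2).trace

/-- The symmetric part of a matrix. -/
noncomputable def sym {r : ℕ} (S : Matrix (Fin r) (Fin r) ℝ) : Matrix (Fin r) (Fin r) ℝ :=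
  (1 / 2 : ℝ) • (S + Sᵀ)

section Objective

variable {n m p r : ℕ}

/-- The transfer function of the error system. -/
noncomputable def errorTransfer (A : Matrix (Fin n) (Fin n) ℝ) (B : Matrix (Fin n) (Fin m) ℝ)
    (C : Matrix (Fin p) (Fin n) ℝ) (x : Space r m p) (s : ℂ) : Matrix (Fin p) (Fin m) ℂ :=
  transferFunction A B C s - transferFunction (x.1 : Matrix (Fin r) (Fin r) ℝ) x.2.1 x.2.2 s

/-- The objective function `J(A_r, B_r, C_r) = ‖G - G_r‖²` in the `H²` norm. -/
noncomputable def J (A : Matrix (Fin n) (Fin n) ℝ) (B : Matrix (Fin n) (Fin m) ℝ)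
    (C : Matrix (Fin p) (Fin n) ℝ) (x : Space r m p) : ℝ :=
  h2Norm (errorTransfer A B C x) ^ 2

/-- The Sylvester equations for `(P, Q, X, Y)` at the point `(A_r, B_r, C_r)`. -/
def SolvesSylvester (A : Matrix (Fin n) (Fin n) ℝ) (B : Matrix (Fin n) (Fin m) ℝ)
    (C : Matrix (Fin p) (Fin n) ℝ)
    (Ar : Matrix (Fin r) (Fin r) ℝ) (Br : Matrix (Fin r) (Fin m) ℝ) (Cr : Matrix (Fin p) (Fin r) ℝ)
    (P Q : Matrix (Fin r) (Fin r) ℝ) (X Y : Matrix (Fin n) (Fin r) ℝ) : Prop :=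
  Ar * P + P * Ar - Br * Brᵀ = 0 ∧
  Ar * Q + Q * Ar - Crᵀ * Cr = 0 ∧
  A * X + X * Ar - B * Brᵀ = 0 ∧
  A * Y + Y * Ar + Cᵀ * Cr = 0

/-- The differentiated equations for `(P', Q', X', Y')` at the point `(A_r, B_r, C_r)`, in the
direction `(A'_r, B'_r, C'_r)`. -/
def SolvesDiffSylvester (A : Matrix (Fin n) (Fin n) ℝ) (B : Matrix (Fin n) (Fin m) ℝ)
    (C : Matrix (Fin p) (Fin n) ℝ)
    (Ar : Matrix (Fin r) (Fin r) ℝ) (Br : Matrix (Fin r) (Fin m) ℝ) (Cr : Matrix (Fin p) (Fin r) ℝ)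
    (Ar' : Matrix (Fin r) (Fin r) ℝ) (Br' : Matrix (Fin r) (Fin m) ℝ)
    (Cr' : Matrix (Fin p) (Fin r) ℝ)
    (P Q : Matrix (Fin r) (Fin r) ℝ) (X Y : Matrix (Fin n) (Fin r) ℝ)
    (P' Q' : Matrix (Fin r) (Fin r) ℝ) (X' Y' : Matrix (Fin n) (Fin r) ℝ) : Prop :=
  Ar * P' + P' * Ar + Ar' * P + P * Ar' - Br' * Brᵀ - Br * Br'ᵀ = 0 ∧
  Ar * Q' + Q' * Ar + Ar' * Q + Q * Ar' - Cr'ᵀ * Cr - Crᵀ * Cr' = 0 ∧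
  A * X' + X' * Ar + X * Ar' - B * Br'ᵀ = 0 ∧
  A * Y' + Y' * Ar + Y * Ar' + Cᵀ * Cr' = 0

end Objective

end ModelReduction

namespace ModelReduction

/-! Diagonalising `A` and `A_r` orthogonally turns each entry of `G - G_r` on the imaginary axis
into a sum of simple fractions `c_k / (iω + δ_k)` with `δ_k > 0`. Its squared modulus integrates to
`2π ∑ c_k c_l / (δ_k + δ_l)`. The numbers `1 / (δ_k + δ_l)` are also what a Sylvester equation
produces in eigenbases, so `J = tr(C P₀ Cᵀ) - 2 tr(C X C_rᵀ) + tr(C_r P C_rᵀ)` with `A P₀ + P₀ A = B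
Bᵀ` (`J_eq_trace`).

A Sylvester operator with positive definite coefficients is injective, hence invertible, and its
inverse depends smoothly on the coefficients. So `P, Q, X, Y` are smooth, and their derivatives
solve the differentiated equations. In `DJ` the unknown `P'` and `X'` are eliminated by duality: the
right-hand sides of the equations for `Q` and `Y` are the matrices paired with them, and the
Sylvester operator can be moved across the trace (`metric_gradField`). Positivity of the metric
makes the vector representing `DJ` unique.

The Koszul formula gives `Γ(u, v) = (-sym(u A_r⁻¹ v), 0, 0)` (`christoffel_metric`); adding it to
the product rule for the gradient yields the Hessian. The geodesic equation reads `A_r'' = A_r'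
A_r⁻¹ A_r'`, with the other components affine in time. Along every solution `K = A_r⁻¹ A_r'` is
constant, so `A_r(t) = A_r(0) exp(tK)`. This gives existence for all times and uniqueness at once
(`IsGeodesicOn.ambient_eq`); conjugation by `A_r(0)^{1/2}` produces the stated symmetric form. -/

/-- The topology of the Frobenius norm, in a form that agrees with the norm at reducible
transparency. -/
noncomputable abbrev frobeniusTopology (l m : Type*) [Fintype l] [Fintype m] :
    TopologicalSpace (Matrix l m ℝ) :=
  Matrix.frobeniusNormedAddCommGroup.toMetricSpace.toUniformSpace.toTopologicalSpace

attribute [local instance 2000] frobeniusTopology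

/-! ### Differential calculus of matrix-valued maps. -/

section MatrixCalculus

variable {l m n : Type*} [Fintype l] [Fintype m] [Fintype n]
  {E : Type*} [NormedAddCommGroup E] [NormedSpace ℝ E]

theorem isBoundedBilinearMap_matrix_mul :
    IsBoundedBilinearMap ℝ (fun q : Matrix l m ℝ × Matrix m n ℝ => q.1 * q.2) where
  add_left := Matrix.add_mul
  smul_left := Matrix.smul_mul
  add_right := Matrix.mul_add
  smul_right c x y := Matrix.mul_smul x c y
  bound := ⟨1, one_pos, fun x y => by simpa using Matrix.frobenius_norm_mul x y⟩

/-- Transposition as a continuous linear map. -/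
noncomputable def transposeCLM : Matrix l m ℝ →L[ℝ] Matrix m l ℝ :=
  LinearMap.toContinuousLinearMap (Matrix.transposeLinearEquiv l m ℝ ℝ).toLinearMap

@[simp] theorem transposeCLM_apply (Z : Matrix l m ℝ) : transposeCLM Z = Zᵀ := rfl

/-- The trace as a continuous linear map. -/
noncomputable def traceCLM : Matrix l l ℝ →L[ℝ] ℝ :=
  LinearMap.toContinuousLinearMap (Matrix.traceLinearMap l ℝ ℝ)

@[simp] theorem traceCLM_apply (Z : Matrix l l ℝ) : traceCLM Z = Z.trace := rfl

theorem _root_.ContDiffAt.matrix_mul {k : WithTop ℕ∞} {x : E} {f : E → Matrix l m ℝ}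
    {g : E → Matrix m n ℝ} (hf : ContDiffAt ℝ k f x) (hg : ContDiffAt ℝ k g x) :
    ContDiffAt ℝ k (fun y => f y * g y) x :=
  ContDiffAt.comp (g := fun q : Matrix l m ℝ × Matrix m n ℝ => q.1 * q.2) x
    isBoundedBilinearMap_matrix_mul.contDiff.contDiffAt (hf.prodMk hg)

theorem _root_.ContDiffAt.matrix_transpose {k : WithTop ℕ∞} {x : E} {f : E → Matrix l m ℝ}
    (hf : ContDiffAt ℝ k f x) : ContDiffAt ℝ k (fun y => (f y)ᵀ) x :=
  (transposeCLM (l := l) (m := m)).contDiff.contDiffAt.comp x hf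

theorem _root_.ContDiffAt.matrix_trace {k : WithTop ℕ∞} {x : E} {f : E → Matrix l l ℝ}
    (hf : ContDiffAt ℝ k f x) : ContDiffAt ℝ k (fun y => (f y).trace) x :=
  (traceCLM (l := l)).contDiff.contDiffAt.comp x hf

theorem _root_.HasFDerivAt.matrix_mul {x : E} {f : E → Matrix l m ℝ} {g : E → Matrix m n ℝ}
    {f' : E →L[ℝ] Matrix l m ℝ} {g' : E →L[ℝ] Matrix m n ℝ}
    (hf : HasFDerivAt f f' x) (hg : HasFDerivAt g g' x) :
    HasFDerivAt (fun y => f y * g y)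
      ((isBoundedBilinearMap_matrix_mul.deriv (f x, g x)).comp (f'.prod g')) x :=
  HasFDerivAt.comp (g := fun q : Matrix l m ℝ × Matrix m n ℝ => q.1 * q.2) x
    (isBoundedBilinearMap_matrix_mul.hasFDerivAt (f x, g x)) (hf.prodMk hg)

theorem _root_.DifferentiableAt.matrix_mul {x : E} {f : E → Matrix l m ℝ} {g : E → Matrix m n ℝ}
    (hf : DifferentiableAt ℝ f x) (hg : DifferentiableAt ℝ g x) :
    DifferentiableAt ℝ (fun y => f y * g y) x :=
  (hf.hasFDerivAt.matrix_mul hg.hasFDerivAt).differentiableAt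

theorem _root_.DifferentiableAt.matrix_transpose {x : E} {f : E → Matrix l m ℝ}
    (hf : DifferentiableAt ℝ f x) : DifferentiableAt ℝ (fun y => (f y)ᵀ) x :=
  (transposeCLM (l := l) (m := m)).differentiableAt.comp x hf

theorem fderiv_matrix_mul {x : E} {f : E → Matrix l m ℝ} {g : E → Matrix m n ℝ}
    (hf : DifferentiableAt ℝ f x) (hg : DifferentiableAt ℝ g x) (ξ : E) :
    fderiv ℝ (fun y => f y * g y) x ξ = fderiv ℝ f x ξ * g x + f x * fderiv ℝ g x ξ := by
  rw [(hf.hasFDerivAt.matrix_mul hg.hasFDerivAt).fderiv]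
  simp [add_comm]

theorem fderiv_matrix_transpose {x : E} {f : E → Matrix l m ℝ}
    (hf : DifferentiableAt ℝ f x) (ξ : E) :
    fderiv ℝ (fun y => (f y)ᵀ) x ξ = (fderiv ℝ f x ξ)ᵀ := by
  have h : HasFDerivAt (fun y => (f y)ᵀ) ((transposeCLM (l := l) (m := m)).comp (fderiv ℝ f x)) x :=
    (transposeCLM (l := l) (m := m)).hasFDerivAt.comp x hf.hasFDerivAt
  rw [h.fderiv]
  simp

theorem fderiv_matrix_trace {x : E} {f : E → Matrix l l ℝ}
    (hf : DifferentiableAt ℝ f x) (ξ : E) :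
    fderiv ℝ (fun y => (f y).trace) x ξ = (fderiv ℝ f x ξ).trace := by
  have h : HasFDerivAt (fun y => (f y).trace) ((traceCLM (l := l)).comp (fderiv ℝ f x)) x :=
    (traceCLM (l := l)).hasFDerivAt.comp x hf.hasFDerivAt
  rw [h.fderiv]
  simp

variable [DecidableEq l]

theorem _root_.ContDiffAt.matrix_inv {k : WithTop ℕ∞} {x : E} {f : E → Matrix l l ℝ}
    (hf : ContDiffAt ℝ k f x) (hu : IsUnit (f x)) : ContDiffAt ℝ k (fun y => (f y)⁻¹) x := by
  simp only [Matrix.nonsing_inv_eq_ringInverse]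
  obtain ⟨u, hu⟩ := hu
  exact ContDiffAt.comp x (hu ▸ contDiffAt_ringInverse ℝ u) hf

theorem fderiv_matrix_inv {x : E} {f : E → Matrix l l ℝ}
    (hf : DifferentiableAt ℝ f x) (hu : IsUnit (f x)) (ξ : E) :
    fderiv ℝ (fun y => (f y)⁻¹) x ξ = -((f x)⁻¹ * fderiv ℝ f x ξ * (f x)⁻¹) := by
  obtain ⟨u, hu⟩ := hu
  have h := hasFDerivAt_ringInverse (𝕜 := ℝ) u
  rw [hu] at h
  have h' := HasFDerivAt.comp x h hf.hasFDerivAt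
  have h2 : (fun y => (f y)⁻¹) = Ring.inverse ∘ f := by
    funext y; simp [Matrix.nonsing_inv_eq_ringInverse]
  rw [h2, h'.fderiv]
  have : (↑u⁻¹ : Matrix l l ℝ) = (f x)⁻¹ := by
    rw [← hu, Matrix.nonsing_inv_eq_ringInverse, Ring.inverse_unit]
  simp [this]

end MatrixCalculus

/-! ### Sylvester equations with positive definite coefficients. -/

section Sylvester

variable {n r : Type*} [Fintype n] [Fintype r]

/-- The Sylvester operator `Z ↦ A Z + Z B`, as a linear function of `(A, B)`. -/
noncomputable def sylvesterOp :
    (Matrix n n ℝ × Matrix r r ℝ) →ₗ[ℝ] (Matrix n r ℝ →L[ℝ] Matrix n r ℝ) where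
  toFun q := LinearMap.toContinuousLinearMap
    { toFun := fun Z => q.1 * Z + Z * q.2
      map_add' := fun Z W => by rw [Matrix.mul_add, Matrix.add_mul]; abel
      map_smul' := fun c Z => by simp }
  map_add' q q' := by
    ext1 Z
    simp [Matrix.mul_add, Matrix.add_mul]; abel
  map_smul' c q := by
    ext1 Z
    simp

@[simp] theorem sylvesterOp_apply (q : Matrix n n ℝ × Matrix r r ℝ) (Z : Matrix n r ℝ) :
    sylvesterOp q Z = q.1 * Z + Z * q.2 := rfl

/-- The solution `Z` of the Sylvester equation `A Z + Z B = R`. -/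
noncomputable def sylvesterSol (A : Matrix n n ℝ) (B : Matrix r r ℝ) (R : Matrix n r ℝ) :
    Matrix n r ℝ :=
  ContinuousLinearMap.inverse (sylvesterOp (A, B)) R

/-- Pairing the equation with `Z` gives `tr(Zᵀ A Z) + tr(Z B Zᵀ) = 0`. Both terms are nonnegative,
so `Zᵀ A Z = 0`, and its diagonal entries are the `A`-norms of the columns of `Z`. -/
theorem eq_zero_of_sylvester_eq_zero {A : Matrix n n ℝ} {B : Matrix r r ℝ} (hA : A.PosDef)
    (hB : B.PosDef) {Z : Matrix n r ℝ} (h : A * Z + Z * B = 0) : Z = 0 := by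
  have h1 : (Zᵀ * A * Z).PosSemidef := by
    simpa using hA.posSemidef.conjTranspose_mul_mul_same Z
  have h2 : (Z * B * Zᵀ).PosSemidef := by
    simpa using hB.posSemidef.mul_mul_conjTranspose_same Z
  have h3 : (Zᵀ * A * Z).trace + (Z * B * Zᵀ).trace = 0 := by
    have := congrArg (fun W => (Zᵀ * W).trace) h
    simp only [Matrix.mul_add, Matrix.trace_add, Matrix.mul_zero, Matrix.trace_zero] at this
    rw [← this, Matrix.mul_assoc, Matrix.trace_mul_comm (Z * B)]
  have h4 : Zᵀ * A * Z = 0 :=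
    h1.trace_eq_zero_iff.1 (le_antisymm (by linarith [h2.trace_nonneg]) h1.trace_nonneg)
  ext i j
  by_contra hne
  have hz : (fun i => Z i j) ≠ 0 := fun h0 => hne (congrFun h0 i)
  have := hA.dotProduct_mulVec_pos hz
  have h5 := congrFun (congrFun h4 j) j
  rw [Matrix.mul_assoc] at h5
  simp only [Matrix.mul_apply, Matrix.transpose_apply, Matrix.zero_apply] at h5
  simp only [dotProduct, Matrix.mulVec, star_trivial] at this
  linarith

theorem isInvertible_sylvesterOp {A : Matrix n n ℝ} {B : Matrix r r ℝ} (hA : A.PosDef)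
    (hB : B.PosDef) : (sylvesterOp (A, B)).IsInvertible := by
  have hinj : Function.Injective (sylvesterOp (A, B) : Matrix n r ℝ →ₗ[ℝ] Matrix n r ℝ) := by
    rw [injective_iff_map_eq_zero]
    exact fun Z hZ => eq_zero_of_sylvester_eq_zero hA hB hZ
  exact ⟨(LinearEquiv.ofInjectiveEndo _ hinj).toContinuousLinearEquiv, by ext1 Z; rfl⟩

theorem sylvester_eq_iff {A : Matrix n n ℝ} {B : Matrix r r ℝ} (hA : A.PosDef)
    (hB : B.PosDef) {Z R : Matrix n r ℝ} : A * Z + Z * B = R ↔ Z = sylvesterSol A B R := by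
  obtain ⟨e, he⟩ := isInvertible_sylvesterOp hA hB
  rw [sylvesterSol, ← he, ContinuousLinearMap.inverse_equiv,
    ContinuousLinearEquiv.coe_coe, ContinuousLinearEquiv.eq_symm_apply]
  change _ ↔ (e : Matrix n r ℝ →L[ℝ] Matrix n r ℝ) Z = R
  rw [he, sylvesterOp_apply]

theorem sylvesterSol_spec {A : Matrix n n ℝ} {B : Matrix r r ℝ} (hA : A.PosDef)
    (hB : B.PosDef) (R : Matrix n r ℝ) :
    A * sylvesterSol A B R + sylvesterSol A B R * B = R :=
  (sylvester_eq_iff hA hB).2 rfl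

/-- The operator is linear in its coefficients, and inversion of continuous linear maps is smooth at
invertible ones. The value `0` that `ContinuousLinearMap.inverse` takes at non-invertible maps plays
no role near such a point. -/
theorem contDiffAt_sylvesterSol {E : Type*} [NormedAddCommGroup E] [NormedSpace ℝ E]
    {k : WithTop ℕ∞} {x : E} {f : E → Matrix n n ℝ} {g : E → Matrix r r ℝ} {h : E → Matrix n r ℝ}
    (hf : ContDiffAt ℝ k f x) (hg : ContDiffAt ℝ k g x) (hh : ContDiffAt ℝ k h x)
    (hfx : (f x).PosDef) (hgx : (g x).PosDef) :
    ContDiffAt ℝ k (fun y => sylvesterSol (f y) (g y) (h y)) x := by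
  have h1 : ContDiffAt ℝ k (fun y => sylvesterOp (f y, g y)) x :=
    (LinearMap.toContinuousLinearMap (sylvesterOp (n := n) (r := r))).contDiff.contDiffAt.comp x
      (hf.prodMk hg)
  exact (ContDiffAt.comp x (isInvertible_sylvesterOp hfx hgx).contDiffAt_map_inverse h1).clm_apply hh

/-- Transposing the equation exchanges the two symmetric coefficients. With equal coefficients and a
symmetric right-hand side this makes `P` and `Q` symmetric. -/
theorem transpose_sylvesterSol {A : Matrix n n ℝ} {B : Matrix r r ℝ} (hA : A.PosDef)
    (hB : B.PosDef) (R : Matrix n r ℝ) :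
    (sylvesterSol A B R)ᵀ = sylvesterSol B A Rᵀ := by
  rw [← sylvester_eq_iff hB hA]
  have hA' : Aᵀ = A := by simpa using hA.isHermitian.eq
  have hB' : Bᵀ = B := by simpa using hB.isHermitian.eq
  conv_rhs => rw [← sylvesterSol_spec hA hB R]
  simp [hA', hB', add_comm]

end Sylvester

end ModelReduction

namespace ModelReduction

/-! ### Partial fractions and Cauchy kernels. -/

section ScalarIntegral

variable {d e : ℝ}

theorem integrable_cauchyKernel (hd : 0 < d) :
    Integrable (fun w : ℝ => d / (d ^ 2 + w ^ 2)) := by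
  have h := (integrable_inv_one_add_sq.comp_div hd.ne').const_mul d⁻¹
  refine h.congr (Filter.Eventually.of_forall fun w => ?_)
  have : d ^ 2 + w ^ 2 ≠ 0 := by positivity
  simp only
  field_simp

theorem integral_cauchyKernel (hd : 0 < d) : ∫ w : ℝ, d / (d ^ 2 + w ^ 2) = Real.pi := by
  have h := Measure.integral_comp_div (fun w : ℝ => (1 + w ^ 2)⁻¹) d
  rw [integral_univ_inv_one_add_sq, abs_of_pos hd, smul_eq_mul] at h
  have h2 : (fun w : ℝ => d / (d ^ 2 + w ^ 2)) = fun w => d⁻¹ * (1 + (w / d) ^ 2)⁻¹ := by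
    funext w
    have : d ^ 2 + w ^ 2 ≠ 0 := by positivity
    field_simp
  rw [h2, integral_const_mul, h]
  field_simp

/-- Both sides equal `(de + w²) / ((d² + w²)(e² + w²))`, because `d(e² + w²) + e(d² + w²) = (d +
e)(de + w²)`. The product is thereby split into kernels with known integrals. -/
theorem resolvent_product (hd : 0 < d) (he : 0 < e) (w : ℝ) :
    ((Complex.I * w + d)⁻¹ * (starRingEnd ℂ) (Complex.I * w + e)⁻¹).re
      = (d / (d ^ 2 + w ^ 2) + e / (e ^ 2 + w ^ 2)) / (d + e) := by
  have h1 : d ^ 2 + w ^ 2 ≠ 0 := by positivity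
  have h2 : e ^ 2 + w ^ 2 ≠ 0 := by positivity
  have h3 : d + e ≠ 0 := by positivity
  simp only [map_inv₀, map_add, map_mul, Complex.conj_I, Complex.conj_ofReal, Complex.mul_re,
    Complex.inv_re, Complex.inv_im, Complex.normSq_apply, Complex.add_re, Complex.add_im,
    Complex.I_re, Complex.I_im, Complex.ofReal_re, Complex.ofReal_im, Complex.neg_re,
    Complex.neg_im, Complex.mul_im]
  have h4 : d * d + w * w ≠ 0 := by simpa [sq] using h1
  have h5 : e * e + w * w ≠ 0 := by simpa [sq] using h2
  simp only [zero_mul, one_mul, mul_zero, zero_add, add_zero, neg_zero, sub_self,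
    neg_mul, mul_neg, neg_neg]
  field_simp
  ring

theorem normSq_partialFractions {κ : Type*} [Fintype κ] {δ : κ → ℝ} (hδ : ∀ k, 0 < δ k)
    (c : κ → ℝ) (w : ℝ) :
    Complex.normSq (∑ k, (c k : ℂ) * (Complex.I * w + δ k)⁻¹)
      = ∑ k, ∑ l, c k * c l / (δ k + δ l)
          * (δ k / (δ k ^ 2 + w ^ 2) + δ l / (δ l ^ 2 + w ^ 2)) := by
  rw [← Complex.ofReal_re (Complex.normSq _), ← Complex.mul_conj, map_sum, Finset.sum_mul_sum,
    Complex.re_sum]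
  refine Finset.sum_congr rfl fun k _ => ?_
  rw [Complex.re_sum]
  refine Finset.sum_congr rfl fun l _ => ?_
  have h := resolvent_product (hδ k) (hδ l) w
  rw [map_mul, Complex.conj_ofReal, mul_mul_mul_comm, ← Complex.ofReal_mul, Complex.re_ofReal_mul,
    h]
  ring

end ScalarIntegral

/-! ### Modal expansion and the trace formula for `J`. -/

section Modal

variable {n m p r : ℕ}

/-- An orthogonal diagonalisation `A = U diag(d) Uᵀ` with positive `d`. -/
structure IsModalForm (A U : Matrix (Fin n) (Fin n) ℝ) (d : Fin n → ℝ) : Prop where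
  transpose_mul : Uᵀ * U = 1
  mul_transpose : U * Uᵀ = 1
  eq : A = U * diagonal d * Uᵀ
  pos : ∀ i, 0 < d i

theorem exists_isModalForm {A : Matrix (Fin n) (Fin n) ℝ} (hA : A.PosDef) :
    ∃ U d, IsModalForm A U d := by
  refine ⟨hA.isHermitian.eigenvectorUnitary, hA.isHermitian.eigenvalues, ?_, ?_, ?_,
    hA.eigenvalues_pos⟩
  · simpa [star_eq_conjTranspose] using Unitary.coe_star_mul_self hA.isHermitian.eigenvectorUnitary
  · simpa [star_eq_conjTranspose] using Unitary.coe_mul_star_self hA.isHermitian.eigenvectorUnitary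
  · simpa [star_eq_conjTranspose, Unitary.conjStarAlgAut_apply, Function.comp_def] using
      hA.isHermitian.spectral_theorem

/-- The eigenbasis of `A` diagonalises the resolvent, which splits `G` into simple poles at `-d k`.
-/
theorem IsModalForm.transferFunction_apply {A U : Matrix (Fin n) (Fin n) ℝ} {d : Fin n → ℝ}
    (h : IsModalForm A U d) (B : Matrix (Fin n) (Fin m) ℝ) (C : Matrix (Fin p) (Fin n) ℝ) (w : ℝ)
    (i : Fin p) (j : Fin m) :
    transferFunction A B C (Complex.I * w) i j
      = ∑ k, (((C * U) i k * (Uᵀ * B) k j : ℝ) : ℂ) * (Complex.I * w + d k)⁻¹ := by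
  set s : ℂ := Complex.I * w
  -- The real part of `s + d k` is `d k > 0`.
  have hs : ∀ k, s + d k ≠ 0 := fun k hk => by
    have := congrArg Complex.re hk
    simp [s] at this
    exact (h.pos k).ne' this
  let φ : ℝ →+* ℂ := Complex.ofRealHom
  have hU : U.map φ * Uᵀ.map φ = 1 := by rw [← Matrix.map_mul, h.mul_transpose]; simp
  have hU' : Uᵀ.map φ * U.map φ = 1 := by rw [← Matrix.map_mul, h.transpose_mul]; simp
  have hinv : (s • (1 : Matrix (Fin n) (Fin n) ℂ) + A.map φ)⁻¹
      = U.map φ * diagonal (fun k => (s + d k)⁻¹) * Uᵀ.map φ := by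
    apply Matrix.inv_eq_right_inv
    have h1 : s • (1 : Matrix (Fin n) (Fin n) ℂ) + A.map φ
        = U.map φ * diagonal (fun k => s + d k) * Uᵀ.map φ := by
      have : diagonal (fun k => s + (d k : ℂ)) = s • (1 : Matrix (Fin n) (Fin n) ℂ)
          + (diagonal d).map φ := by
        rw [Matrix.diagonal_map (map_zero φ), ← Matrix.diagonal_one, ← Matrix.diagonal_smul,
          Matrix.diagonal_add]
        congr 1; funext k; simp [φ]
      rw [this, Matrix.mul_add, Matrix.add_mul, Matrix.mul_smul, Matrix.mul_one, Matrix.smul_mul,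
        hU, h.eq, Matrix.map_mul, Matrix.map_mul]
    rw [h1]
    calc _ = U.map φ * (diagonal (fun k => s + d k) * (Uᵀ.map φ * U.map φ)
        * diagonal (fun k => (s + d k)⁻¹)) * Uᵀ.map φ := by simp only [Matrix.mul_assoc]
      _ = 1 := by
        rw [hU', Matrix.mul_one, Matrix.diagonal_mul_diagonal]
        simp only [mul_inv_cancel₀ (hs _), Matrix.diagonal_one, Matrix.mul_one, hU]
  have h2 : transferFunction A B C s
      = (C * U).map φ * diagonal (fun k => (s + d k)⁻¹) * (Uᵀ * B).map φ := by
    change C.map φ * (s • (1 : Matrix (Fin n) (Fin n) ℂ) + A.map φ)⁻¹ * B.map φ = _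
    rw [hinv, Matrix.map_mul, Matrix.map_mul]
    simp only [Matrix.mul_assoc]
  rw [h2, Matrix.mul_apply]
  refine Finset.sum_congr rfl fun k _ => ?_
  rw [Matrix.mul_diagonal]
  simp only [Matrix.map_apply, φ, Complex.ofRealHom_eq_coe, Complex.ofReal_mul]
  ring

/-- In the two eigenbases the Sylvester equation decouples into scalar equations `(d₁ k + d₂ l) W k
l = R k l`; the denominators of the modal sum are the entries of the inverse Sylvester operator. -/
theorem IsModalForm.sum_eq_trace {A₁ U₁ : Matrix (Fin n) (Fin n) ℝ} {d₁ : Fin n → ℝ}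
    {A₂ U₂ : Matrix (Fin r) (Fin r) ℝ} {d₂ : Fin r → ℝ}
    (h₁ : IsModalForm A₁ U₁ d₁) (h₂ : IsModalForm A₂ U₂ d₂)
    {B₁ : Matrix (Fin n) (Fin m) ℝ} {B₂ : Matrix (Fin r) (Fin m) ℝ}
    (C₁ : Matrix (Fin p) (Fin n) ℝ) (C₂ : Matrix (Fin p) (Fin r) ℝ)
    {Z : Matrix (Fin n) (Fin r) ℝ} (hZ : A₁ * Z + Z * A₂ = B₁ * B₂ᵀ) :
    ∑ i, ∑ j, ∑ k, ∑ l, ((C₁ * U₁) i k * (U₁ᵀ * B₁) k j) * ((C₂ * U₂) i l * (U₂ᵀ * B₂) l j)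
      / (d₁ k + d₂ l) = (C₁ * Z * C₂ᵀ).trace := by
  set W := U₁ᵀ * Z * U₂ with hW
  have hW' : diagonal d₁ * W + W * diagonal d₂ = (U₁ᵀ * B₁) * (U₂ᵀ * B₂)ᵀ := by
    have e1 : U₁ᵀ * A₁ = diagonal d₁ * U₁ᵀ := by
      rw [h₁.eq, ← Matrix.mul_assoc, ← Matrix.mul_assoc, h₁.transpose_mul, Matrix.one_mul]
    have e2 : A₂ * U₂ = U₂ * diagonal d₂ := by
      rw [h₂.eq, Matrix.mul_assoc, h₂.transpose_mul, Matrix.mul_one]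
    calc _ = U₁ᵀ * (A₁ * Z + Z * A₂) * U₂ := by
          rw [Matrix.mul_add, Matrix.add_mul, ← Matrix.mul_assoc U₁ᵀ A₁, e1]
          simp only [hW, Matrix.mul_assoc, e2]
      _ = _ := by rw [hZ]; simp [Matrix.mul_assoc]
  have hWkl : ∀ k l, W k l = (∑ j, (U₁ᵀ * B₁) k j * (U₂ᵀ * B₂) l j) / (d₁ k + d₂ l) := by
    intro k l
    have := congrFun (congrFun hW' k) l
    rw [Matrix.add_apply, Matrix.diagonal_mul, Matrix.mul_diagonal, Matrix.mul_apply] at this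
    rw [eq_div_iff (add_pos (h₁.pos k) (h₂.pos l)).ne']
    simp only [Matrix.transpose_apply (U₂ᵀ * B₂)] at this
    rw [← this]; ring
  have hZ' : C₁ * Z * C₂ᵀ = (C₁ * U₁) * W * (C₂ * U₂)ᵀ := by
    calc _ = C₁ * (U₁ * U₁ᵀ) * Z * (U₂ * U₂ᵀ) * C₂ᵀ := by
          rw [h₁.mul_transpose, h₂.mul_transpose, Matrix.mul_one, Matrix.mul_one]
      _ = _ := by simp [hW, Matrix.mul_assoc]
  rw [hZ', Matrix.trace]
  refine Finset.sum_congr rfl fun i _ => ?_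
  rw [Matrix.diag_apply, Matrix.mul_apply]
  rw [Finset.sum_comm, Finset.sum_congr rfl fun k _ => Finset.sum_comm, Finset.sum_comm]
  refine Finset.sum_congr rfl fun l _ => ?_
  rw [Matrix.mul_apply (M := C₁ * U₁) (N := W), Finset.sum_mul]
  refine Finset.sum_congr rfl fun k _ => ?_
  rw [hWkl, Matrix.transpose_apply, Finset.sum_div, Finset.mul_sum, Finset.sum_mul]
  refine Finset.sum_congr rfl fun j _ => ?_
  ring

theorem powerSpectrum_eq_sum_normSq (G : ℂ → Matrix (Fin p) (Fin m) ℂ) (w : ℝ) :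
    powerSpectrum G w = ∑ i, ∑ j, Complex.normSq (G (Complex.I * w) i j) := by
  rw [powerSpectrum, Matrix.trace, Complex.re_sum, Finset.sum_comm]
  refine Finset.sum_congr rfl fun j _ => ?_
  rw [Matrix.diag_apply, Matrix.mul_apply, Complex.re_sum]
  refine Finset.sum_congr rfl fun i _ => ?_
  rw [Matrix.conjTranspose_apply, Complex.star_def, mul_comm, Complex.mul_conj, Complex.ofReal_re]

theorem powerSpectrum_nonneg (G : ℂ → Matrix (Fin p) (Fin m) ℂ) (w : ℝ) :
    0 ≤ powerSpectrum G w := by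
  rw [powerSpectrum_eq_sum_normSq]
  exact Finset.sum_nonneg fun i _ => Finset.sum_nonneg fun j _ => Complex.normSq_nonneg _

theorem h2Norm_sq (G : ℂ → Matrix (Fin p) (Fin m) ℂ) :
    h2Norm G ^ 2 = (1 / (2 * Real.pi)) * ∫ w : ℝ, powerSpectrum G w :=
  Real.sq_sqrt (mul_nonneg (by positivity) (integral_nonneg (powerSpectrum_nonneg G)))

/-- The error system is treated as one modal expansion indexed by the disjoint union of both sets of
modes, with the residues of the reduced system negated. -/
theorem powerSpectrum_errorTransfer {A U : Matrix (Fin n) (Fin n) ℝ} {d : Fin n → ℝ}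
    (h : IsModalForm A U d) (B : Matrix (Fin n) (Fin m) ℝ) (C : Matrix (Fin p) (Fin n) ℝ)
    (x : Space r m p) {V : Matrix (Fin r) (Fin r) ℝ} {e : Fin r → ℝ}
    (h' : IsModalForm x.1.1 V e) (w : ℝ) :
    let δ := Sum.elim d e
    let c := fun i j => Sum.elim (fun k => (C * U) i k * (Uᵀ * B) k j)
      (fun k => -((x.2.2 * V) i k * (Vᵀ * x.2.1) k j))
    powerSpectrum (errorTransfer A B C x) w = ∑ i, ∑ j, ∑ k, ∑ l, c i j k * c i j l / (δ k + δ l)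
          * (δ k / (δ k ^ 2 + w ^ 2) + δ l / (δ l ^ 2 + w ^ 2)) := by
  intro δ c
  have hδ : ∀ k, 0 < δ k := by
    rintro (k | k)
    exacts [h.pos k, h'.pos k]
  rw [powerSpectrum_eq_sum_normSq]
  refine Finset.sum_congr rfl fun i _ => Finset.sum_congr rfl fun j _ => ?_
  rw [← normSq_partialFractions hδ (c i j) w, errorTransfer, Matrix.sub_apply,
    h.transferFunction_apply, h'.transferFunction_apply, Fintype.sum_sum_type]
  simp only [δ, c, Sum.elim_inl, Sum.elim_inr]
  simp only [Complex.ofReal_neg, neg_mul, Finset.sum_neg_distrib, sub_eq_add_neg]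

theorem integrable_powerSpectrum_errorTransfer {A : Matrix (Fin n) (Fin n) ℝ} (hA : A.PosDef)
    (B : Matrix (Fin n) (Fin m) ℝ) (C : Matrix (Fin p) (Fin n) ℝ) {x : Space r m p}
    (hx : x ∈ M r m p) : Integrable (powerSpectrum (errorTransfer A B C x)) := by
  obtain ⟨U, d, h⟩ := exists_isModalForm hA
  obtain ⟨V, e, h'⟩ := exists_isModalForm (A := x.1.1) hx
  have hδ : ∀ k, 0 < Sum.elim d e k := by
    rintro (k | k)
    exacts [h.pos k, h'.pos k]
  rw [funext (powerSpectrum_errorTransfer h B C x h')]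
  refine integrable_finsetSum _ fun i _ => integrable_finsetSum _ fun j _ =>
    integrable_finsetSum _ fun k _ => integrable_finsetSum _ fun l _ => ?_
  exact ((integrable_cauchyKernel (hδ k)).add (integrable_cauchyKernel (hδ l))).const_mul _

/-- The double sum over modes splits into four blocks. The diagonal blocks give the terms in `P₀`
and `P`; the two mixed blocks coincide and give the factor `-2`. -/
theorem J_eq_trace {A : Matrix (Fin n) (Fin n) ℝ} (hA : A.PosDef)
    (B : Matrix (Fin n) (Fin m) ℝ) (C : Matrix (Fin p) (Fin n) ℝ) {x : Space r m p}
    (hx : x ∈ M r m p) {P₀ : Matrix (Fin n) (Fin n) ℝ} {X : Matrix (Fin n) (Fin r) ℝ}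
    {P : Matrix (Fin r) (Fin r) ℝ} (hP₀ : A * P₀ + P₀ * A = B * Bᵀ)
    (hX : A * X + X * x.1.1 = B * x.2.1ᵀ) (hP : x.1.1 * P + P * x.1.1 = x.2.1 * x.2.1ᵀ) :
    J A B C x = (C * P₀ * Cᵀ).trace - 2 * (C * X * x.2.2ᵀ).trace
      + (x.2.2 * P * x.2.2ᵀ).trace := by
  obtain ⟨U, d, h⟩ := exists_isModalForm hA
  obtain ⟨V, e, h'⟩ := exists_isModalForm (A := x.1.1) hx
  have hδ : ∀ k, 0 < Sum.elim d e k := by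
    rintro (k | k)
    exacts [h.pos k, h'.pos k]
  have hint : ∀ k, Integrable (fun w : ℝ => Sum.elim d e k / (Sum.elim d e k ^ 2 + w ^ 2)) :=
    fun k => integrable_cauchyKernel (hδ k)
  rw [J, h2Norm_sq, funext (powerSpectrum_errorTransfer h B C x h'),
    ← h.sum_eq_trace h C C hP₀, ← h.sum_eq_trace h' C x.2.2 hX, ← h'.sum_eq_trace h' x.2.2 x.2.2 hP]
  have hi4 : ∀ (a : ℝ) k l, Integrable (fun w : ℝ => a * (Sum.elim d e k /
      (Sum.elim d e k ^ 2 + w ^ 2) + Sum.elim d e l / (Sum.elim d e l ^ 2 + w ^ 2))) :=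
    fun a k l => ((hint k).add (hint l)).const_mul a
  rw [integral_finsetSum _ fun i _ => integrable_finsetSum _ fun j _ =>
    integrable_finsetSum _ fun k _ => integrable_finsetSum _ fun l _ => hi4 _ k l,
    Finset.mul_sum, Finset.mul_sum, ← Finset.sum_sub_distrib, ← Finset.sum_add_distrib]
  refine Finset.sum_congr rfl fun i _ => ?_
  rw [integral_finsetSum _ fun j _ => integrable_finsetSum _ fun k _ =>
    integrable_finsetSum _ fun l _ => hi4 _ k l,
    Finset.mul_sum, Finset.mul_sum, ← Finset.sum_sub_distrib, ← Finset.sum_add_distrib]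
  refine Finset.sum_congr rfl fun j _ => ?_
  -- Each of the two kernels integrates to `π`; the resulting `2π` cancels the normalisation of the
  -- `H²` norm.
  have key : ∀ (a : ℝ) k l, ∫ w : ℝ, a * (Sum.elim d e k /
      (Sum.elim d e k ^ 2 + w ^ 2) + Sum.elim d e l / (Sum.elim d e l ^ 2 + w ^ 2))
      = 2 * Real.pi * a := by
    intro a k l
    rw [integral_const_mul, integral_add (hint k) (hint l), integral_cauchyKernel (hδ k),
      integral_cauchyKernel (hδ l)]
    ring
  rw [integral_finsetSum _ fun k _ => integrable_finsetSum _ fun l _ => hi4 _ k l,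
    Finset.sum_congr rfl fun k _ => integral_finsetSum _ fun l _ => hi4 _ k l]
  simp only [key]
  simp only [← Finset.mul_sum]
  rw [← mul_assoc, one_div_mul_cancel (by positivity), one_mul]
  simp only [Fintype.sum_sum_type, Sum.elim_inl, Sum.elim_inr, Finset.sum_add_distrib]
  have hcomm : ∑ k : Fin r, ∑ l : Fin n, -((x.2.2 * V) i k * (Vᵀ * x.2.1) k j)
        * ((C * U) i l * (Uᵀ * B) l j) / (e k + d l)
      = ∑ k : Fin n, ∑ l : Fin r, ((C * U) i k * (Uᵀ * B) k j)
        * -((x.2.2 * V) i l * (Vᵀ * x.2.1) l j) / (d k + e l) := by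
    rw [Finset.sum_comm]
    refine Finset.sum_congr rfl fun k _ => Finset.sum_congr rfl fun l _ => ?_
    rw [mul_comm, add_comm]
  rw [hcomm]
  simp only [mul_neg, neg_mul, neg_neg, neg_div, Finset.sum_neg_distrib]
  ring

end Modal

/-- With `A⁻¹ = Tᵀ T` the trace becomes the squared Frobenius norm of `T v Tᵀ`. If that vanishes, so
does `A⁻¹ v A⁻¹`, and then `v`. -/
theorem trace_inv_mul_pos {r : ℕ} {A v : Matrix (Fin r) (Fin r) ℝ} (hA : A.PosDef) (hv : vᵀ = v)
    (hv0 : v ≠ 0) : 0 < (A⁻¹ * v * A⁻¹ * v).trace := by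
  obtain ⟨T, hT⟩ := CStarAlgebra.nonneg_iff_eq_star_mul_self.1 hA.inv.posSemidef.nonneg
  rw [star_eq_conjTranspose, Matrix.conjTranspose_eq_transpose_of_trivial] at hT
  have h1 : (A⁻¹ * v * A⁻¹ * v).trace = ((T * v * Tᵀ)ᵀ * (T * v * Tᵀ)).trace := by
    rw [hT]
    calc _ = (Tᵀ * (T * v * Tᵀ * T * v)).trace := by simp only [Matrix.mul_assoc]
      _ = _ := by rw [Matrix.trace_mul_comm]; simp [hv, Matrix.mul_assoc]
  rw [h1]
  have h2 : 0 ≤ ((T * v * Tᵀ)ᵀ * (T * v * Tᵀ)).trace := by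
    simpa using (Matrix.posSemidef_conjTranspose_mul_self (T * v * Tᵀ)).trace_nonneg
  refine lt_of_le_of_ne h2 fun h0 => hv0 ?_
  have h3 : T * v * Tᵀ = 0 := by
    rw [← Matrix.trace_conjTranspose_mul_self_eq_zero_iff]
    simpa using h0.symm
  have h4 : A⁻¹ * v * A⁻¹ = 0 := by
    rw [hT]
    calc _ = Tᵀ * (T * v * Tᵀ) * T := by simp only [Matrix.mul_assoc]
      _ = 0 := by rw [h3]; simp
  have hu : IsUnit A.det := (Matrix.isUnit_iff_isUnit_det A).1 hA.isUnit
  calc v = A * (A⁻¹ * v * A⁻¹) * A := by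
        rw [Matrix.mul_assoc A⁻¹, Matrix.mul_nonsing_inv_cancel_left _ _ hu,
          Matrix.nonsing_inv_mul_cancel_right _ _ hu]
    _ = 0 := by rw [h4]; simp

end ModelReduction

namespace ModelReduction

attribute [local instance 2000] frobeniusTopology

/-! ### Symmetric part and coordinates on `Space`. -/

section Space

variable {r m p : ℕ}

/-- The orthogonal projection `S ↦ sym S` onto the symmetric matrices. -/
noncomputable def symPart (r : ℕ) : Matrix (Fin r) (Fin r) ℝ →L[ℝ] symMatrices r :=
  LinearMap.toContinuousLinearMap
    { toFun := fun S => ⟨sym S, by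
        change (sym S)ᵀ = sym S
        simp [sym, add_comm]⟩
      map_add' := fun S T => by
        ext1
        simp only [sym, Matrix.transpose_add, Submodule.coe_add]
        module
      map_smul' := fun c S => by
        ext1
        simp only [sym, Matrix.transpose_smul, Submodule.coe_smul, RingHom.id_apply]
        module }

@[simp] theorem coe_symPart (S : Matrix (Fin r) (Fin r) ℝ) : (symPart r S).1 = sym S := rfl

theorem sym_eq_self {S : Matrix (Fin r) (Fin r) ℝ} (hS : Sᵀ = S) : sym S = S := by
  rw [sym, hS]; module

@[simp] theorem transpose_coe_symMatrices (S : symMatrices r) : S.1ᵀ = S.1 := S.2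

theorem trace_sym_mul (S : Matrix (Fin r) (Fin r) ℝ) {T : Matrix (Fin r) (Fin r) ℝ}
    (hT : Tᵀ = T) : (sym S * T).trace = (S * T).trace := by
  have : (Sᵀ * T).trace = (S * T).trace := by
    rw [← Matrix.trace_transpose, Matrix.transpose_mul, hT, Matrix.transpose_transpose,
      Matrix.trace_mul_comm]
  rw [sym, Matrix.smul_mul, Matrix.add_mul, Matrix.trace_smul, Matrix.trace_add, this, smul_eq_mul]
  ring

theorem ext_ambient {x y : Space r m p} (h : ambient x = ambient y) : x = y := by
  simp only [ambient, Prod.mk.injEq] at h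
  exact Prod.ext (Subtype.ext h.1) (Prod.ext h.2.1 h.2.2)

/-- The first coordinate of `Space r m p`, as a matrix. -/
noncomputable def coordA (r m p : ℕ) : Space r m p →L[ℝ] Matrix (Fin r) (Fin r) ℝ :=
  (symMatrices r).subtypeL.comp (ContinuousLinearMap.fst ℝ _ _)

/-- The second coordinate of `Space r m p`. -/
noncomputable def coordB (r m p : ℕ) : Space r m p →L[ℝ] Matrix (Fin r) (Fin m) ℝ :=
  (ContinuousLinearMap.fst ℝ _ _).comp (ContinuousLinearMap.snd ℝ _ _)

/-- The third coordinate of `Space r m p`. -/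
noncomputable def coordC (r m p : ℕ) : Space r m p →L[ℝ] Matrix (Fin p) (Fin r) ℝ :=
  (ContinuousLinearMap.snd ℝ _ _).comp (ContinuousLinearMap.snd ℝ _ _)

theorem contDiffAt_A {k : WithTop ℕ∞} (x : Space r m p) :
    ContDiffAt ℝ k (fun y : Space r m p => y.1.1) x := (coordA r m p).contDiff.contDiffAt

theorem contDiffAt_B {k : WithTop ℕ∞} (x : Space r m p) :
    ContDiffAt ℝ k (fun y : Space r m p => y.2.1) x := (coordB r m p).contDiff.contDiffAt

theorem contDiffAt_C {k : WithTop ℕ∞} (x : Space r m p) :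
    ContDiffAt ℝ k (fun y : Space r m p => y.2.2) x := (coordC r m p).contDiff.contDiffAt

theorem differentiableAt_A (x : Space r m p) :
    DifferentiableAt ℝ (fun y : Space r m p => y.1.1) x := (coordA r m p).differentiableAt

theorem differentiableAt_B (x : Space r m p) :
    DifferentiableAt ℝ (fun y : Space r m p => y.2.1) x := (coordB r m p).differentiableAt

theorem differentiableAt_C (x : Space r m p) :
    DifferentiableAt ℝ (fun y : Space r m p => y.2.2) x := (coordC r m p).differentiableAt

theorem fderiv_A (x ξ : Space r m p) :
    fderiv ℝ (fun y : Space r m p => y.1.1) x ξ = ξ.1.1 := by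
  have h : HasFDerivAt (fun y : Space r m p => y.1.1) (coordA r m p) x := (coordA r m p).hasFDerivAt
  rw [h.fderiv]; rfl

theorem fderiv_B (x ξ : Space r m p) :
    fderiv ℝ (fun y : Space r m p => y.2.1) x ξ = ξ.2.1 := by
  have h : HasFDerivAt (fun y : Space r m p => y.2.1) (coordB r m p) x := (coordB r m p).hasFDerivAt
  rw [h.fderiv]; rfl

theorem fderiv_C (x ξ : Space r m p) :
    fderiv ℝ (fun y : Space r m p => y.2.2) x ξ = ξ.2.2 := by
  have h : HasFDerivAt (fun y : Space r m p => y.2.2) (coordC r m p) x := (coordC r m p).hasFDerivAt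
  rw [h.fderiv]; rfl

theorem isUnit_of_mem {x : Space r m p} (hx : x ∈ M r m p) : IsUnit x.1.1 :=
  Matrix.PosDef.isUnit hx

end Space

/-! ### Openness of `M`. -/

section Open

/-- Eigenvalues of `F` are bounded by `‖F‖ * ‖1‖`, so those of `1 + F` are positive. The factor
`‖1‖` is needed because the Frobenius norm of the identity need not be `1`. -/
theorem posDef_one_add {r : ℕ} {F : Matrix (Fin r) (Fin r) ℝ} (hF : Fᵀ = F)
    (h : ‖F‖ * ‖(1 : Matrix (Fin r) (Fin r) ℝ)‖ < 1) : (1 + F).PosDef := by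
  have hherm : (1 + F).IsHermitian := by
    change (1 + F)ᴴ = _
    simp [hF]
  rw [hherm.posDef_iff_eigenvalues_pos]
  intro i
  have h1 := hherm.eigenvalues_mem_spectrum_real i
  have h2 : hherm.eigenvalues i - 1 ∈ spectrum ℝ F := by
    rw [spectrum.mem_iff] at h1 ⊢
    convert h1 using 2
    rw [map_sub, map_one]; abel
  have h3 := spectrum.norm_le_norm_mul_of_mem h2
  rw [Real.norm_eq_abs] at h3
  linarith [(abs_lt.1 (h3.trans_lt h)).1]

/-- The congruence by `U D`, with `D` the inverse square roots of the eigenvalues, carries the base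
point to the identity and a nearby `y` to `1 + F y` with `F y` small. Positivity is then transported
back by the inverse congruence. -/
theorem isOpen_M (r m p : ℕ) : IsOpen (M r m p) := by
  rw [isOpen_iff_mem_nhds]
  intro x hx
  obtain ⟨U, d, h⟩ := exists_isModalForm (A := x.1.1) hx
  let D := diagonal fun k => (Real.sqrt (d k))⁻¹
  let D' := diagonal fun k => Real.sqrt (d k)
  have hs : ∀ k, Real.sqrt (d k) ≠ 0 := fun k => (Real.sqrt_pos.2 (h.pos k)).ne'
  have hDD : D * D' = 1 := by simp [D, D', Matrix.diagonal_mul_diagonal, hs]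
  have hDD' : D' * D = 1 := by simp [D, D', Matrix.diagonal_mul_diagonal, hs]
  have hd : diagonal d = D' * D' := by
    simp [D', Matrix.diagonal_mul_diagonal, Real.mul_self_sqrt (h.pos _).le]
  let F : Space r m p → Matrix (Fin r) (Fin r) ℝ := fun y => D * Uᵀ * y.1.1 * (U * D) - 1
  have hFc : ContinuousAt F x := by
    have h1 : ContDiffAt ℝ 0 F x :=
      ((contDiffAt_const.matrix_mul (contDiffAt_A x)).matrix_mul contDiffAt_const).sub
        contDiffAt_const
    exact h1.continuousAt
  have hFx : F x = 0 := by
    have : D * Uᵀ * x.1.1 * (U * D) = D * (Uᵀ * U) * D' * D' * (Uᵀ * U) * D := by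
      rw [h.eq, hd]; simp only [Matrix.mul_assoc]
    simp only [F]
    rw [this, h.transpose_mul, Matrix.mul_one, Matrix.mul_one, hDD, Matrix.one_mul, hDD', sub_self]
  have hlim : Filter.Tendsto (fun y => ‖F y‖ * ‖(1 : Matrix (Fin r) (Fin r) ℝ)‖) (nhds x) (nhds 0) := by
    have := (hFc.norm).mul_const ‖(1 : Matrix (Fin r) (Fin r) ℝ)‖
    simpa [ContinuousAt, hFx] using this
  filter_upwards [hlim.eventually (gt_mem_nhds one_pos)] with y hy
  have hFs : (F y)ᵀ = F y := by
    simp [F, D, Matrix.mul_assoc]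
  have h1 := posDef_one_add hFs hy
  have h2 : y.1.1 = (D' * Uᵀ)ᴴ * (1 + F y) * (D' * Uᵀ) := by
    have : (D' * Uᵀ)ᴴ * (1 + F y) * (D' * Uᵀ)
        = U * (D' * D) * Uᵀ * y.1.1 * U * (D * D') * Uᵀ := by
      simp [F, D', Matrix.mul_assoc]
    rw [this, hDD, hDD', Matrix.mul_one, Matrix.mul_one, h.mul_transpose, Matrix.one_mul,
      Matrix.mul_assoc, h.mul_transpose, Matrix.mul_one]
  change (y.1.1).PosDef
  rw [h2]
  refine h1.conjTranspose_mul_mul_same ?_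
  refine Matrix.mulVec_injective_of_isUnit ?_
  refine IsUnit.of_mul_eq_one (U * D) ?_
  rw [Matrix.mul_assoc, ← Matrix.mul_assoc Uᵀ, h.transpose_mul, Matrix.one_mul, hDD']

end Open

/-! ### Uniqueness of the representing vector. -/

section Sharp

variable {E : Type*} [NormedAddCommGroup E] [NormedSpace ℝ E] {g : E → E → E → ℝ} {U : Set E}

/-- The vector `v` shows that the choice in `sharp` succeeds. The difference of two representing
vectors is orthogonal to everything, itself included. -/
theorem IsRiemannianMetricOn.sharp_eq (hg : IsRiemannianMetricOn g U) {x : E} (hx : x ∈ U)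
    {ℓ : E → ℝ} {v : E} (hv : ∀ w, g x v w = ℓ w) : sharp g x ℓ = v := by
  have h1 : ∀ w, g x (sharp g x ℓ) w = ℓ w :=
    Classical.epsilon_spec (p := fun v => ∀ w, g x v w = ℓ w) ⟨v, hv⟩
  by_contra hne
  have h2 := hg.pos x hx (sharp g x ℓ - v) (sub_ne_zero.2 hne)
  have h3 : sharp g x ℓ - v = sharp g x ℓ + (-1 : ℝ) • v := by module
  have h4 : ∀ w, g x (sharp g x ℓ - v) w = 0 := fun w => by
    rw [h3, hg.add_left x hx, hg.smul_left x hx, h1, hv]; ring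
  rw [h4] at h2
  exact lt_irrefl _ h2

end Sharp

/-! ### The metric and its Christoffel map. -/

section Metric

variable {r m p : ℕ}

theorem trace_transpose_mul_self_nonneg {k l : ℕ} (v : Matrix (Fin k) (Fin l) ℝ) :
    0 ≤ (vᵀ * v).trace := by
  simpa using (Matrix.posSemidef_conjTranspose_mul_self v).trace_nonneg

theorem trace_transpose_mul_self_pos {k l : ℕ} {v : Matrix (Fin k) (Fin l) ℝ} (hv : v ≠ 0) :
    0 < (vᵀ * v).trace := by
  refine lt_of_le_of_ne (trace_transpose_mul_self_nonneg v) fun h0 => hv ?_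
  rw [← Matrix.trace_conjTranspose_mul_self_eq_zero_iff]
  simpa using h0.symm

theorem contDiffAt_metric {k : WithTop ℕ∞} {x : Space r m p} (hx : x ∈ M r m p)
    (v w : Space r m p) : ContDiffAt ℝ k (fun y => metric r m p y v w) x := by
  have hi := (contDiffAt_A (k := k) x).matrix_inv (isUnit_of_mem hx)
  exact ((((hi.matrix_mul contDiffAt_const).matrix_mul hi).matrix_mul
    contDiffAt_const).matrix_trace.add contDiffAt_const).add contDiffAt_const

theorem isRiemannianMetricOn_metric (r m p : ℕ) :
    IsRiemannianMetricOn (metric r m p) (M r m p) where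
  smooth v w x hx := (contDiffAt_metric hx v w).contDiffWithinAt
  add_left x _ v₁ v₂ w := by
    simp only [metric, Prod.fst_add, Prod.snd_add, Submodule.coe_add, Matrix.mul_add,
      Matrix.add_mul, Matrix.transpose_add, Matrix.trace_add]
    ring
  smul_left x _ a v w := by
    simp only [metric, Prod.smul_fst, Prod.smul_snd, Submodule.coe_smul, Matrix.mul_smul,
      Matrix.smul_mul, Matrix.transpose_smul, Matrix.trace_smul, smul_eq_mul]
    ring
  symm x _ v w := by
    simp only [metric]
    congr 1
    · congr 1
      · rw [Matrix.mul_assoc, Matrix.trace_mul_comm]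
        simp only [Matrix.mul_assoc]
      · rw [← Matrix.trace_transpose, Matrix.transpose_mul, Matrix.transpose_transpose]
    · rw [← Matrix.trace_transpose, Matrix.transpose_mul, Matrix.transpose_transpose]
  pos x hx v hv := by
    have h1 : 0 ≤ (x.1.1⁻¹ * v.1.1 * x.1.1⁻¹ * v.1.1).trace := by
      by_cases h : v.1.1 = 0
      · simp [h]
      · exact (trace_inv_mul_pos hx v.1.2 h).le
    have h2 := trace_transpose_mul_self_nonneg v.2.1
    have h3 := trace_transpose_mul_self_nonneg v.2.2
    simp only [metric]
    by_cases h : v.1.1 = 0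
    · by_cases h' : v.2.1 = 0
      · have h'' : v.2.2 ≠ 0 := fun h'' =>
          hv (Prod.ext (Subtype.ext h) (Prod.ext h' h''))
        linarith [trace_transpose_mul_self_pos h'']
      · linarith [trace_transpose_mul_self_pos h']
    · linarith [trace_inv_mul_pos hx v.1.2 h]

theorem fderiv_metric {x : Space r m p} (hx : x ∈ M r m p) (v w u : Space r m p) :
    fderiv ℝ (fun y => metric r m p y v w) x u
      = -(x.1.1⁻¹ * u.1.1 * x.1.1⁻¹ * v.1.1 * x.1.1⁻¹ * w.1.1).trace
        - (x.1.1⁻¹ * v.1.1 * x.1.1⁻¹ * u.1.1 * x.1.1⁻¹ * w.1.1).trace := by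
  have hi : DifferentiableAt ℝ (fun y : Space r m p => (y.1.1)⁻¹) x :=
    ((contDiffAt_A (k := 1) x).matrix_inv (isUnit_of_mem hx)).differentiableAt one_ne_zero
  have hv := differentiableAt_const (𝕜 := ℝ) (x := x) v.1.1
  have hw := differentiableAt_const (𝕜 := ℝ) (x := x) w.1.1
  simp only [metric, add_assoc]
  rw [fderiv_add_const, fderiv_matrix_trace (((hi.matrix_mul hv).matrix_mul hi).matrix_mul hw),
    fderiv_matrix_mul ((hi.matrix_mul hv).matrix_mul hi) hw,
    fderiv_matrix_mul (hi.matrix_mul hv) hi, fderiv_matrix_mul hi hv,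
    fderiv_matrix_inv (differentiableAt_A x) (isUnit_of_mem hx), fderiv_A]
  simp only [fderiv_fun_const, Pi.zero_apply, _root_.zero_apply, Matrix.mul_zero,
    add_zero, Matrix.neg_mul, Matrix.mul_neg, Matrix.add_mul, Matrix.trace_add, Matrix.trace_neg,
    Matrix.mul_assoc]
  ring

/-- Write `a(u, v, w) = tr(R u R v R w)` with `R = A_r⁻¹`. By cyclicity each of the three
derivatives in the Koszul formula equals `-a(u, v, w) - a(v, u, w)`, so one survives; half of it is
the pairing of `-sym(u R v)` with `w`. -/
theorem christoffel_metric {x : Space r m p} (hx : x ∈ M r m p) (u v : Space r m p) :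
    christoffel (metric r m p) x u v = (-symPart r (u.1.1 * x.1.1⁻¹ * v.1.1), 0, 0) := by
  refine (isRiemannianMetricOn_metric r m p).sharp_eq hx fun w => ?_
  simp only [fderiv_metric hx]
  set R := x.1.1⁻¹ with hR
  have c1 : (R * w.1.1 * R * u.1.1 * R * v.1.1).trace = (R * u.1.1 * R * v.1.1 * R * w.1.1).trace := by
    rw [Matrix.mul_assoc, Matrix.mul_assoc, Matrix.mul_assoc, Matrix.trace_mul_comm]
    simp only [Matrix.mul_assoc]
  have c2 : (R * u.1.1 * R * w.1.1 * R * v.1.1).trace = (R * v.1.1 * R * u.1.1 * R * w.1.1).trace := by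
    rw [Matrix.mul_assoc, Matrix.trace_mul_comm]
    simp only [Matrix.mul_assoc]
  have e : sym (u.1.1 * R * v.1.1) = (1 / 2 : ℝ) • (u.1.1 * R * v.1.1 + v.1.1 * R * u.1.1) := by
    have hRt : Rᵀ = R := by rw [hR, Matrix.transpose_nonsing_inv, transpose_coe_symMatrices]
    simp [sym, hRt, Matrix.mul_assoc]
  simp only [metric, Submodule.coe_neg, coe_symPart, e, Matrix.transpose_zero, Matrix.zero_mul,
    Matrix.trace_zero, add_zero, ← hR, c1, c2]
  simp only [Matrix.mul_neg, Matrix.neg_mul, Matrix.mul_smul, Matrix.smul_mul, Matrix.trace_neg,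
    Matrix.trace_smul, Matrix.mul_add, Matrix.add_mul, Matrix.trace_add, smul_eq_mul,
    Matrix.mul_assoc]
  ring

end Metric

end ModelReduction

namespace ModelReduction

attribute [local instance 2000] frobeniusTopology

theorem eventually_mem_M {r m p : ℕ} {x : Space r m p} (hx : x ∈ M r m p) :
    ∀ᶠ y in nhds x, y ∈ M r m p :=
  (isOpen_M r m p).mem_nhds hx

/-! ### The matrices `P, Q, X, Y` as smooth functions on `M`. -/

section Gramians

variable {n m p r : ℕ} (A : Matrix (Fin n) (Fin n) ℝ) (B : Matrix (Fin n) (Fin m) ℝ)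
  (C : Matrix (Fin p) (Fin n) ℝ)

/-- The solution `P` of `A_r P + P A_r = B_r B_rᵀ`. -/
noncomputable def solP (x : Space r m p) : Matrix (Fin r) (Fin r) ℝ :=
  sylvesterSol x.1.1 x.1.1 (x.2.1 * x.2.1ᵀ)

/-- The solution `Q` of `A_r Q + Q A_r = C_rᵀ C_r`. -/
noncomputable def solQ (x : Space r m p) : Matrix (Fin r) (Fin r) ℝ :=
  sylvesterSol x.1.1 x.1.1 (x.2.2ᵀ * x.2.2)

/-- The solution `X` of `A X + X A_r = B B_rᵀ`. -/
noncomputable def solX (x : Space r m p) : Matrix (Fin n) (Fin r) ℝ :=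
  sylvesterSol A x.1.1 (B * x.2.1ᵀ)

/-- The solution `Y` of `A Y + Y A_r = -Cᵀ C_r`. -/
noncomputable def solY (x : Space r m p) : Matrix (Fin n) (Fin r) ℝ :=
  sylvesterSol A x.1.1 (-(Cᵀ * x.2.2))

variable {x : Space r m p}

theorem transpose_solP (hx : x ∈ M r m p) : (solP x)ᵀ = solP x := by
  rw [solP, transpose_sylvesterSol hx hx]; simp

theorem transpose_solQ (hx : x ∈ M r m p) : (solQ x)ᵀ = solQ x := by
  rw [solQ, transpose_sylvesterSol hx hx]; simp

theorem contDiffAt_solP {k : WithTop ℕ∞} (hx : x ∈ M r m p) :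
    ContDiffAt ℝ k (solP (r := r) (m := m) (p := p)) x :=
  contDiffAt_sylvesterSol (contDiffAt_A x) (contDiffAt_A x)
    ((contDiffAt_B x).matrix_mul (contDiffAt_B x).matrix_transpose) hx hx

theorem contDiffAt_solQ {k : WithTop ℕ∞} (hx : x ∈ M r m p) :
    ContDiffAt ℝ k (solQ (r := r) (m := m) (p := p)) x :=
  contDiffAt_sylvesterSol (contDiffAt_A x) (contDiffAt_A x)
    ((contDiffAt_C x).matrix_transpose.matrix_mul (contDiffAt_C x)) hx hx

variable {A}

theorem contDiffAt_solX {k : WithTop ℕ∞} (hA : A.PosDef) (hx : x ∈ M r m p) :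
    ContDiffAt ℝ k (solX (r := r) (p := p) A B) x :=
  contDiffAt_sylvesterSol contDiffAt_const (contDiffAt_A x)
    (contDiffAt_const.matrix_mul (contDiffAt_B x).matrix_transpose) hA hx

theorem contDiffAt_solY {k : WithTop ℕ∞} (hA : A.PosDef) (hx : x ∈ M r m p) :
    ContDiffAt ℝ k (solY (r := r) (m := m) A C) x :=
  contDiffAt_sylvesterSol contDiffAt_const (contDiffAt_A x)
    (contDiffAt_const.matrix_mul (contDiffAt_C x)).neg hA hx

theorem solvesSylvester_iff (hA : A.PosDef) (hx : x ∈ M r m p)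
    (P Q : Matrix (Fin r) (Fin r) ℝ) (X Y : Matrix (Fin n) (Fin r) ℝ) :
    SolvesSylvester A B C x.1.1 x.2.1 x.2.2 P Q X Y ↔
      P = solP x ∧ Q = solQ x ∧ X = solX A B x ∧ Y = solY A C x := by
  have hx' : x.1.1.PosDef := hx
  rw [SolvesSylvester, sub_eq_zero, sub_eq_zero, sub_eq_zero, ← eq_neg_iff_add_eq_zero,
    sylvester_eq_iff hx' hx', sylvester_eq_iff hx' hx', sylvester_eq_iff hA hx',
    sylvester_eq_iff hA hx']
  rfl

theorem solvesSylvester_sol (hA : A.PosDef) (hx : x ∈ M r m p) :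
    SolvesSylvester A B C x.1.1 x.2.1 x.2.2 (solP x) (solQ x) (solX A B x) (solY A C x) :=
  (solvesSylvester_iff B C hA hx _ _ _ _).2 ⟨rfl, rfl, rfl, rfl⟩

end Gramians

/-! ### Differentiated Sylvester equations. -/

section Derivatives

variable {n m p r : ℕ} {A : Matrix (Fin n) (Fin n) ℝ} {B : Matrix (Fin n) (Fin m) ℝ}
  {C : Matrix (Fin p) (Fin n) ℝ} {x : Space r m p}

theorem fderiv_of_sylvester_eq {E : Type*} [NormedAddCommGroup E] [NormedSpace ℝ E] {k l : ℕ}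
    {x : E} {f : E → Matrix (Fin k) (Fin k) ℝ} {g : E → Matrix (Fin l) (Fin l) ℝ}
    {h Z : E → Matrix (Fin k) (Fin l) ℝ} (hf : DifferentiableAt ℝ f x)
    (hg : DifferentiableAt ℝ g x) (hZ : DifferentiableAt ℝ Z x)
    (heq : ∀ᶠ y in nhds x, f y * Z y + Z y * g y = h y) (ξ : E) :
    f x * fderiv ℝ Z x ξ + fderiv ℝ Z x ξ * g x + fderiv ℝ f x ξ * Z x + Z x * fderiv ℝ g x ξ
      = fderiv ℝ h x ξ := by
  rw [← Filter.EventuallyEq.fderiv_eq heq, fderiv_fun_add (hf.matrix_mul hZ) (hZ.matrix_mul hg),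
    _root_.add_apply, fderiv_matrix_mul hf hZ, fderiv_matrix_mul hZ hg]
  abel

theorem sylvester_eq_iff_of_eq {k l : ℕ} {F : Matrix (Fin k) (Fin k) ℝ}
    {G : Matrix (Fin l) (Fin l) ℝ} (hF : F.PosDef) (hG : G.PosDef)
    {Z Z₁ K : Matrix (Fin k) (Fin l) ℝ} (hZ : F * Z + Z * G + K = 0) :
    F * Z₁ + Z₁ * G + K = 0 ↔ Z₁ = Z := by
  refine ⟨fun h => ?_, fun h => h ▸ hZ⟩
  rw [← sub_eq_zero]
  refine eq_zero_of_sylvester_eq_zero hF hG ?_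
  calc F * (Z₁ - Z) + (Z₁ - Z) * G = (F * Z₁ + Z₁ * G + K) - (F * Z + Z * G + K) := by
        rw [Matrix.mul_sub, Matrix.sub_mul]; abel
    _ = 0 := by rw [h, hZ, sub_zero]

theorem fderiv_solP (hx : x ∈ M r m p) (ξ : Space r m p) :
    x.1.1 * fderiv ℝ solP x ξ + fderiv ℝ solP x ξ * x.1.1 + ξ.1.1 * solP x + solP x * ξ.1.1
      = ξ.2.1 * x.2.1ᵀ + x.2.1 * ξ.2.1ᵀ := by
  have h := fderiv_of_sylvester_eq (differentiableAt_A x) (differentiableAt_A x)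
    ((contDiffAt_solP (k := 1) hx).differentiableAt one_ne_zero)
    ((eventually_mem_M hx).mono fun y hy => sylvesterSol_spec hy hy (y.2.1 * y.2.1ᵀ)) ξ
  rwa [fderiv_A, fderiv_matrix_mul (differentiableAt_B x) (differentiableAt_B x).matrix_transpose,
    fderiv_matrix_transpose (differentiableAt_B x), fderiv_B] at h

theorem fderiv_solQ (hx : x ∈ M r m p) (ξ : Space r m p) :
    x.1.1 * fderiv ℝ solQ x ξ + fderiv ℝ solQ x ξ * x.1.1 + ξ.1.1 * solQ x + solQ x * ξ.1.1
      = ξ.2.2ᵀ * x.2.2 + x.2.2ᵀ * ξ.2.2 := by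
  have h := fderiv_of_sylvester_eq (differentiableAt_A x) (differentiableAt_A x)
    ((contDiffAt_solQ (k := 1) hx).differentiableAt one_ne_zero)
    ((eventually_mem_M hx).mono fun y hy => sylvesterSol_spec hy hy (y.2.2ᵀ * y.2.2)) ξ
  rwa [fderiv_A, fderiv_matrix_mul (differentiableAt_C x).matrix_transpose (differentiableAt_C x),
    fderiv_matrix_transpose (differentiableAt_C x), fderiv_C] at h

theorem fderiv_solX (hA : A.PosDef) (hx : x ∈ M r m p) (ξ : Space r m p) :
    A * fderiv ℝ (solX A B) x ξ + fderiv ℝ (solX A B) x ξ * x.1.1 + solX A B x * ξ.1.1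
      = B * ξ.2.1ᵀ := by
  have h := fderiv_of_sylvester_eq (differentiableAt_const A) (differentiableAt_A x)
    ((contDiffAt_solX (k := 1) B hA hx).differentiableAt one_ne_zero)
    ((eventually_mem_M hx).mono fun y hy => sylvesterSol_spec hA hy (B * y.2.1ᵀ)) ξ
  rw [fderiv_A, fderiv_matrix_mul (differentiableAt_const B) (differentiableAt_B x).matrix_transpose,
    fderiv_matrix_transpose (differentiableAt_B x), fderiv_B] at h
  simpa using h

theorem fderiv_solY (hA : A.PosDef) (hx : x ∈ M r m p) (ξ : Space r m p) :
    A * fderiv ℝ (solY A C) x ξ + fderiv ℝ (solY A C) x ξ * x.1.1 + solY A C x * ξ.1.1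
      = -(Cᵀ * ξ.2.2) := by
  have h := fderiv_of_sylvester_eq (differentiableAt_const A) (differentiableAt_A x)
    ((contDiffAt_solY (k := 1) C hA hx).differentiableAt one_ne_zero)
    ((eventually_mem_M hx).mono fun y hy => sylvesterSol_spec hA hy (-(Cᵀ * y.2.2))) ξ
  rw [fderiv_A, fderiv_fun_neg, _root_.neg_apply,
    fderiv_matrix_mul (differentiableAt_const Cᵀ) (differentiableAt_C x), fderiv_C] at h
  simpa using h

/-- The differentiated equations have the same Sylvester operators as the original ones, hence
unique solutions, and the derivatives of `P, Q, X, Y` solve them. -/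
theorem solvesDiffSylvester_iff (hA : A.PosDef) (hx : x ∈ M r m p) (ξ : Space r m p)
    (P' Q' : Matrix (Fin r) (Fin r) ℝ) (X' Y' : Matrix (Fin n) (Fin r) ℝ) :
    SolvesDiffSylvester A B C x.1.1 x.2.1 x.2.2 ξ.1.1 ξ.2.1 ξ.2.2 (solP x) (solQ x) (solX A B x)
        (solY A C x) P' Q' X' Y' ↔
      P' = fderiv ℝ solP x ξ ∧ Q' = fderiv ℝ solQ x ξ ∧ X' = fderiv ℝ (solX A B) x ξ ∧
        Y' = fderiv ℝ (solY A C) x ξ := by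
  have hx' : x.1.1.PosDef := hx
  have hP := sub_eq_zero.2 (fderiv_solP hx ξ)
  have hQ := sub_eq_zero.2 (fderiv_solQ hx ξ)
  have hX := sub_eq_zero.2 (fderiv_solX (B := B) hA hx ξ)
  have hY := sub_eq_zero.2 (fderiv_solY (C := C) hA hx ξ)
  simp only [add_assoc, add_sub_assoc] at hP hQ hX hY
  rw [← add_assoc] at hP hQ hX hY
  rw [← sylvester_eq_iff_of_eq hx' hx' hP, ← sylvester_eq_iff_of_eq hx' hx' hQ,
    ← sylvester_eq_iff_of_eq hA hx' hX, ← sylvester_eq_iff_of_eq hA hx' hY, SolvesDiffSylvester]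
  simp only [sub_eq_add_neg, neg_add, neg_neg, add_assoc]

end Derivatives

/-! ### The gradient of `J`. -/

section Gradient

variable {n m p r : ℕ} {A : Matrix (Fin n) (Fin n) ℝ} (B : Matrix (Fin n) (Fin m) ℝ)
  (C : Matrix (Fin p) (Fin n) ℝ) {x : Space r m p}

theorem J_eventuallyEq (hA : A.PosDef) (hx : x ∈ M r m p) :
    J A B C =ᶠ[nhds x] fun y => (C * sylvesterSol A A (B * Bᵀ) * Cᵀ).trace
      + ((-2 : ℝ) * (C * solX A B y * y.2.2ᵀ).trace + (y.2.2 * solP y * y.2.2ᵀ).trace) := by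
  filter_upwards [eventually_mem_M hx] with y hy
  rw [J_eq_trace hA B C hy (sylvesterSol_spec hA hA _) (sylvesterSol_spec hA hy _)
    (sylvesterSol_spec hy hy _)]
  simp only [solX, solP]
  ring

theorem contDiffAt_J {k : WithTop ℕ∞} (hA : A.PosDef) (hx : x ∈ M r m p) :
    ContDiffAt ℝ k (J A B C) x := by
  refine ContDiffAt.congr_of_eventuallyEq ?_ (J_eventuallyEq B C hA hx)
  exact contDiffAt_const.add ((contDiffAt_const.mul ((contDiffAt_const.matrix_mul
    (contDiffAt_solX B hA hx)).matrix_mul (contDiffAt_C x).matrix_transpose).matrix_trace).add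
    (((contDiffAt_C x).matrix_mul (contDiffAt_solP hx)).matrix_mul
      (contDiffAt_C x).matrix_transpose).matrix_trace)

theorem fderiv_J (hA : A.PosDef) (hx : x ∈ M r m p) (ξ : Space r m p) :
    fderiv ℝ (J A B C) x ξ =
      -2 * ((C * fderiv ℝ (solX A B) x ξ * x.2.2ᵀ).trace + (C * solX A B x * ξ.2.2ᵀ).trace)
      + ((ξ.2.2 * solP x * x.2.2ᵀ).trace + (x.2.2 * fderiv ℝ solP x ξ * x.2.2ᵀ).trace
        + (x.2.2 * solP x * ξ.2.2ᵀ).trace) := by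
  have hC := differentiableAt_C x
  have hCt := hC.matrix_transpose
  have hP := (contDiffAt_solP (k := 1) hx).differentiableAt one_ne_zero
  have hX := (contDiffAt_solX (k := 1) B hA hx).differentiableAt one_ne_zero
  have hCX := (differentiableAt_const (x := x) (𝕜 := ℝ) C).matrix_mul hX
  have hCP := hC.matrix_mul hP
  have h1 : DifferentiableAt ℝ (fun y : Space r m p => (C * solX A B y * y.2.2ᵀ).trace) x :=
    (traceCLM (l := Fin p)).differentiableAt.comp x (hCX.matrix_mul hCt)
  have h2 : DifferentiableAt ℝ (fun y : Space r m p => (y.2.2 * solP y * y.2.2ᵀ).trace) x :=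
    (traceCLM (l := Fin p)).differentiableAt.comp x (hCP.matrix_mul hCt)
  rw [(J_eventuallyEq B C hA hx).fderiv_eq, fderiv_const_add, fderiv_fun_add (h1.const_mul _) h2,
    fderiv_const_mul h1, _root_.add_apply, _root_.smul_apply,
    fderiv_matrix_trace (hCX.matrix_mul hCt), fderiv_matrix_trace (hCP.matrix_mul hCt),
    fderiv_matrix_mul hCX hCt, fderiv_matrix_mul hCP hCt, fderiv_matrix_mul hC hP,
    fderiv_matrix_mul (differentiableAt_const C) hX, fderiv_matrix_transpose hC, fderiv_C]
  simp [Matrix.add_mul]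

variable (A) in
/-- The matrix `Q P + Yᵀ X`. -/
noncomputable def solS (x : Space r m p) : Matrix (Fin r) (Fin r) ℝ :=
  solQ x * solP x + (solY A C x)ᵀ * solX A B x

variable (A) in
/-- The gradient field of `J`. -/
noncomputable def gradField (x : Space r m p) : Space r m p :=
  (symPart r (-(2 : ℝ) • (x.1.1 * solS A B C x * x.1.1)),
    (2 : ℝ) • (solQ x * x.2.1 + (solY A C x)ᵀ * B),
    (2 : ℝ) • (x.2.2 * solP x - C * solX A B x))

theorem trace_transpose_mul_eq {k l : ℕ} (K L : Matrix (Fin k) (Fin l) ℝ) :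
    (Kᵀ * L).trace = (K * Lᵀ).trace := by
  rw [← Matrix.trace_transpose, Matrix.transpose_mul, Matrix.transpose_transpose,
    Matrix.trace_mul_comm]

/-- Adjoint method: `C_rᵀ C_r` and `C_rᵀ C` are replaced through the equations for `Q` and `Y`. The
Sylvester operator then falls on `P'` and `X'`, where the differentiated equations express it by the
direction `ξ`. -/
theorem metric_gradField (hA : A.PosDef) (hx : x ∈ M r m p) (ξ : Space r m p) :
    metric r m p x (gradField A B C x) ξ = fderiv ℝ (J A B C) x ξ := by
  rw [fderiv_J B C hA hx ξ]
  have hdP := fderiv_solP hx ξ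
  have hdX := fderiv_solX (B := B) hA hx ξ
  obtain ⟨-, hQ, -, hY⟩ := solvesSylvester_sol B C hA hx
  have hPt := transpose_solP hx
  have hQt := transpose_solQ hx
  have hAt : Aᵀ = A := by simpa using hA.isHermitian.eq
  have hu : IsUnit x.1.1.det := (Matrix.isUnit_iff_isUnit_det _).1 (isUnit_of_mem hx)
  have hart : x.1.1ᵀ = x.1.1 := transpose_coe_symMatrices _
  have hξt : ξ.1.1ᵀ = ξ.1.1 := transpose_coe_symMatrices _
  simp only [metric, gradField, coe_symPart, solS]
  -- From here on only the matrix equations in the context matter; the claim is an identity of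
  -- traces.
  generalize fderiv ℝ solP x ξ = P' at *
  generalize fderiv ℝ (solX A B) x ξ = X' at *
  generalize solP x = P at *
  generalize solQ x = Q at *
  generalize solX A B x = X at *
  generalize solY A C x = Y at *
  generalize x.1.1 = Ar at *
  generalize x.2.1 = Br at *
  generalize x.2.2 = Cr at *
  generalize ξ.1.1 = Ar' at *
  generalize ξ.2.1 = Br' at *
  generalize ξ.2.2 = Cr' at *
  -- The outer factors `Ar` cancel the inverses in the metric, and `sym` may be dropped against the
  -- symmetric `Ar'`.
  have e1 : (Ar⁻¹ * sym (-(2 : ℝ) • (Ar * (Q * P + Yᵀ * X) * Ar)) * Ar⁻¹ * Ar').trace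
      = -2 * ((Q * P * Ar').trace + (Yᵀ * X * Ar').trace) := by
    have : sym (-(2 : ℝ) • (Ar * (Q * P + Yᵀ * X) * Ar))
        = Ar * (-(2 : ℝ) • sym (Q * P + Yᵀ * X)) * Ar := by
      simp only [sym, Matrix.transpose_smul, Matrix.transpose_mul, hart, Matrix.mul_smul,
        Matrix.smul_mul, Matrix.mul_add, Matrix.add_mul, Matrix.transpose_add, Matrix.mul_assoc]
      module
    rw [this, ← Matrix.mul_assoc, Matrix.nonsing_inv_mul_cancel_left _ _ hu,
      Matrix.mul_nonsing_inv_cancel_right _ _ hu, Matrix.smul_mul, Matrix.trace_smul,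
      trace_sym_mul _ hξt, Matrix.add_mul, Matrix.trace_add, smul_eq_mul]
  have e2 : (Cr * P' * Crᵀ).trace = 2 * (Q * Br * Br'ᵀ).trace - 2 * (Q * P * Ar').trace := by
    have a1 : (Cr * P' * Crᵀ).trace = (Q * (Ar * P' + P' * Ar)).trace := by
      rw [Matrix.trace_mul_comm, ← Matrix.mul_assoc, ← sub_eq_zero.1 hQ, Matrix.add_mul,
        Matrix.mul_add, Matrix.trace_add, Matrix.trace_add, Matrix.mul_assoc Ar,
        Matrix.trace_mul_comm Ar, add_comm]
      simp only [Matrix.mul_assoc]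
    have a2 : Ar * P' + P' * Ar = Br' * Brᵀ + Br * Br'ᵀ - Ar' * P - P * Ar' := by
      rw [← hdP]; abel
    have a3 : (Q * (Br' * Brᵀ)).trace = (Q * Br * Br'ᵀ).trace := by
      rw [← Matrix.trace_transpose, Matrix.transpose_mul, Matrix.trace_mul_comm]
      simp [hQt, Matrix.mul_assoc]
    have a4 : (Q * (Ar' * P)).trace = (Q * P * Ar').trace := by
      rw [← Matrix.trace_transpose, Matrix.transpose_mul, Matrix.trace_mul_comm]
      simp [hQt, hPt, hξt, Matrix.mul_assoc]
    rw [a1, a2]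
    simp only [Matrix.mul_sub, Matrix.mul_add, Matrix.trace_sub, Matrix.trace_add, a3, a4]
    simp only [Matrix.mul_assoc]
    ring
  have e3 : (C * X' * Crᵀ).trace = -(Yᵀ * B * Br'ᵀ).trace + (Yᵀ * X * Ar').trace := by
    have a0 : Crᵀ * C = -(Yᵀ * A + Ar * Yᵀ) := by
      have := congrArg Matrix.transpose hY
      simp only [Matrix.transpose_add, Matrix.transpose_mul, hAt, hart, Matrix.transpose_transpose,
        Matrix.transpose_zero] at this
      exact (neg_eq_of_add_eq_zero_right this).symm
    have a1 : (C * X' * Crᵀ).trace = -(Yᵀ * (A * X' + X' * Ar)).trace := by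
      rw [Matrix.trace_mul_comm, ← Matrix.mul_assoc, a0, Matrix.neg_mul, Matrix.trace_neg,
        Matrix.add_mul, Matrix.mul_add, Matrix.trace_add, Matrix.trace_add, Matrix.mul_assoc Ar,
        Matrix.trace_mul_comm Ar]
      simp only [Matrix.mul_assoc]
    have a2 : A * X' + X' * Ar = B * Br'ᵀ - X * Ar' := by rw [← hdX]; abel
    rw [a1, a2, Matrix.mul_sub, Matrix.trace_sub]
    simp only [Matrix.mul_assoc]
    ring
  have e4 : (Cr' * P * Crᵀ).trace = (Cr * P * Cr'ᵀ).trace := by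
    rw [← Matrix.trace_transpose]
    simp [hPt, Matrix.mul_assoc]
  rw [e1, e2, e3, e4, trace_transpose_mul_eq, trace_transpose_mul_eq]
  simp only [Matrix.smul_mul, Matrix.trace_smul, Matrix.add_mul, Matrix.sub_mul, Matrix.trace_add,
    Matrix.trace_sub, smul_eq_mul]
  ring

theorem riemGrad_eq (hA : A.PosDef) (hx : x ∈ M r m p) :
    riemGrad (metric r m p) (J A B C) x = gradField A B C x :=
  (isRiemannianMetricOn_metric r m p).sharp_eq hx (metric_gradField B C hA hx)

theorem sym_smul_conj {k : ℕ} {F : Matrix (Fin k) (Fin k) ℝ} (hF : Fᵀ = F) (c : ℝ)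
    (S : Matrix (Fin k) (Fin k) ℝ) : sym (c • (F * S * F)) = c • (F * sym S * F) := by
  simp only [sym, Matrix.transpose_smul, Matrix.transpose_mul, hF, Matrix.mul_smul,
    Matrix.smul_mul, Matrix.mul_add, Matrix.add_mul, Matrix.mul_assoc]
  module

theorem ambient_gradField (x : Space r m p) :
    ambient (gradField A B C x) = (-(2 : ℝ) • (x.1.1 * sym (solS A B C x) * x.1.1),
      (2 : ℝ) • (solQ x * x.2.1 + (solY A C x)ᵀ * B),
      (2 : ℝ) • (x.2.2 * solP x - C * solX A B x)) := by
  rw [ambient, gradField, coe_symPart, sym_smul_conj (transpose_coe_symMatrices _)]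

end Gradient

end ModelReduction

namespace ModelReduction

attribute [local instance 2000] frobeniusTopology

/-! ### The Hessian of `J`. -/

section Hessian

variable {n m p r : ℕ} {A : Matrix (Fin n) (Fin n) ℝ} (B : Matrix (Fin n) (Fin m) ℝ)
  (C : Matrix (Fin p) (Fin n) ℝ) {x : Space r m p}

theorem fderiv_const_smul_matrix {E : Type*} [NormedAddCommGroup E] [NormedSpace ℝ E] {k l : ℕ}
    {x : E} {f : E → Matrix (Fin k) (Fin l) ℝ} (hf : DifferentiableAt ℝ f x) (c : ℝ) (ξ : E) :
    fderiv ℝ (fun y => c • f y) x ξ = c • fderiv ℝ f x ξ := by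
  have h : HasFDerivAt (fun y => c • f y) (c • fderiv ℝ f x) x := hf.hasFDerivAt.const_smul c
  rw [h.fderiv]; rfl

theorem hasFDerivAt_gradField (hA : A.PosDef) (hx : x ∈ M r m p) :
    ∃ L : Space r m p →L[ℝ] Space r m p, HasFDerivAt (gradField A B C) L x ∧ ∀ ξ,
      L ξ = (symPart r (-(2 : ℝ) • ((ξ.1.1 * solS A B C x + x.1.1 *
          (fderiv ℝ solQ x ξ * solP x + solQ x * fderiv ℝ solP x ξ
            + ((fderiv ℝ (solY A C) x ξ)ᵀ * solX A B x
              + (solY A C x)ᵀ * fderiv ℝ (solX A B) x ξ))) * x.1.1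
          + x.1.1 * solS A B C x * ξ.1.1)),
        (2 : ℝ) • (fderiv ℝ solQ x ξ * x.2.1 + solQ x * ξ.2.1 + (fderiv ℝ (solY A C) x ξ)ᵀ * B),
        (2 : ℝ) • (ξ.2.2 * solP x + x.2.2 * fderiv ℝ solP x ξ
          - C * fderiv ℝ (solX A B) x ξ)) := by
  have hAr := differentiableAt_A x
  have hBr := differentiableAt_B x
  have hCr := differentiableAt_C x
  have hP := (contDiffAt_solP (k := 1) hx).differentiableAt one_ne_zero
  have hQ := (contDiffAt_solQ (k := 1) hx).differentiableAt one_ne_zero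
  have hX := (contDiffAt_solX (k := 1) B hA hx).differentiableAt one_ne_zero
  have hY := (contDiffAt_solY (k := 1) C hA hx).differentiableAt one_ne_zero
  have hQP := hQ.matrix_mul hP
  have hYX := hY.matrix_transpose.matrix_mul hX
  have hS : DifferentiableAt ℝ (solS A B C) x := hQP.add hYX
  have hAS := hAr.matrix_mul hS
  have hASA := hAS.matrix_mul hAr
  have hQB := hQ.matrix_mul hBr
  have hYB := hY.matrix_transpose.matrix_mul (differentiableAt_const (𝕜 := ℝ) (x := x) B)
  have hCP := hCr.matrix_mul hP
  have hCX := (differentiableAt_const (𝕜 := ℝ) (x := x) C).matrix_mul hX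
  have hB : DifferentiableAt ℝ (fun y : Space r m p => solQ y * y.2.1 + (solY A C y)ᵀ * B) x :=
    hQB.add hYB
  have hC : DifferentiableAt ℝ (fun y : Space r m p => y.2.2 * solP y - C * solX A B y) x :=
    hCP.sub hCX
  have h1 := (symPart r).hasFDerivAt.comp x (hASA.const_smul (-(2 : ℝ))).hasFDerivAt
  have h2 := (hB.const_smul (2 : ℝ)).hasFDerivAt
  have h3 := (hC.const_smul (2 : ℝ)).hasFDerivAt
  refine ⟨_, h1.prodMk (h2.prodMk h3), fun ξ => ?_⟩
  have e1 : fderiv ℝ (solS A B C) x ξ = fderiv ℝ solQ x ξ * solP x + solQ x * fderiv ℝ solP x ξ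
      + ((fderiv ℝ (solY A C) x ξ)ᵀ * solX A B x
        + (solY A C x)ᵀ * fderiv ℝ (solX A B) x ξ) := by
    have : fderiv ℝ (solS A B C) x = _ := fderiv_fun_add hQP hYX
    rw [this, _root_.add_apply, fderiv_matrix_mul hQ hP,
      fderiv_matrix_mul hY.matrix_transpose hX, fderiv_matrix_transpose hY]
  refine Prod.ext ?_ (Prod.ext ?_ ?_)
  · change symPart r (fderiv ℝ (fun y : Space r m p =>
      -(2 : ℝ) • (y.1.1 * solS A B C y * y.1.1)) x ξ) = _
    rw [fderiv_const_smul_matrix hASA, fderiv_matrix_mul hAS hAr, fderiv_matrix_mul hAr hS,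
      fderiv_A, e1]
  · change fderiv ℝ (fun y : Space r m p => (2 : ℝ) • (solQ y * y.2.1 + (solY A C y)ᵀ * B)) x ξ = _
    rw [fderiv_const_smul_matrix hB, fderiv_fun_add hQB hYB, _root_.add_apply,
      fderiv_matrix_mul hQ hBr, fderiv_matrix_mul hY.matrix_transpose (differentiableAt_const B),
      fderiv_matrix_transpose hY, fderiv_B]
    simp
  · change fderiv ℝ (fun y : Space r m p => (2 : ℝ) • (y.2.2 * solP y - C * solX A B y)) x ξ = _
    rw [fderiv_const_smul_matrix hC, fderiv_fun_sub hCP hCX, _root_.sub_apply,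
      fderiv_matrix_mul hCr hP, fderiv_matrix_mul (differentiableAt_const C) hX, fderiv_C]
    simp

theorem riemGrad_eventuallyEq (hA : A.PosDef) (hx : x ∈ M r m p) :
    riemGrad (metric r m p) (J A B C) =ᶠ[nhds x] gradField A B C :=
  (eventually_mem_M hx).mono fun _ hy => riemGrad_eq B C hA hy

theorem differentiableAt_riemGrad (hA : A.PosDef) (hx : x ∈ M r m p) :
    DifferentiableAt ℝ (riemGrad (metric r m p) (J A B C)) x := by
  obtain ⟨L, hL, -⟩ := hasFDerivAt_gradField B C hA hx
  exact hL.differentiableAt.congr_of_eventuallyEq (riemGrad_eventuallyEq B C hA hx)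

/-- Differentiating the two outer factors `F` contributes `-4 sym(G (sym S) F)`; the Christoffel
term gives back `+2 sym(G (sym S) F)`, which leaves the coefficient `-2`. -/
theorem sym_product_rule {k : ℕ} {F G S : Matrix (Fin k) (Fin k) ℝ} (hF : Fᵀ = F) (hG : Gᵀ = G)
    (S' : Matrix (Fin k) (Fin k) ℝ) :
    sym (-(2 : ℝ) • ((G * S + F * S') * F + F * S * G)) + -sym (-(2 : ℝ) • (G * (sym S * F)))
      = -(2 : ℝ) • (F * sym S' * F) - (2 : ℝ) • sym (G * sym S * F) := by
  simp only [sym, Matrix.transpose_smul, Matrix.transpose_mul, Matrix.transpose_add,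
    Matrix.transpose_transpose, hF, hG, Matrix.mul_smul,
    Matrix.smul_mul, Matrix.mul_add, Matrix.add_mul, Matrix.mul_assoc]
  module

theorem ambient_riemHess (hA : A.PosDef) (hx : x ∈ M r m p) (ξ : Space r m p) :
    ambient (riemHess (metric r m p) (J A B C) x ξ) =
      (-(2 : ℝ) • (x.1.1 * sym (fderiv ℝ solQ x ξ * solP x + solQ x * fderiv ℝ solP x ξ
            + (fderiv ℝ (solY A C) x ξ)ᵀ * solX A B x
            + (solY A C x)ᵀ * fderiv ℝ (solX A B) x ξ) * x.1.1)
          - (2 : ℝ) • sym (ξ.1.1 * sym (solQ x * solP x + (solY A C x)ᵀ * solX A B x) * x.1.1),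
        (2 : ℝ) • (fderiv ℝ solQ x ξ * x.2.1 + solQ x * ξ.2.1 + (fderiv ℝ (solY A C) x ξ)ᵀ * B),
        (2 : ℝ) • (ξ.2.2 * solP x + x.2.2 * fderiv ℝ solP x ξ
          - C * fderiv ℝ (solX A B) x ξ)) := by
  obtain ⟨L, hL, hLξ⟩ := hasFDerivAt_gradField B C hA hx
  have hu : IsUnit x.1.1.det := (Matrix.isUnit_iff_isUnit_det _).1 (isUnit_of_mem hx)
  have hg : (gradField A B C x).1.1 = -(2 : ℝ) • (x.1.1 * sym (solS A B C x) * x.1.1) := by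
    rw [gradField, coe_symPart, sym_smul_conj (transpose_coe_symMatrices _)]
  have hfd : fderiv ℝ (riemGrad (metric r m p) (J A B C)) x = L := by
    rw [(riemGrad_eventuallyEq B C hA hx).fderiv_eq, hL.fderiv]
  have hinv : ξ.1.1 * x.1.1⁻¹ * (-(2 : ℝ) • (x.1.1 * sym (solS A B C x) * x.1.1))
      = -(2 : ℝ) • (ξ.1.1 * (sym (solS A B C x) * x.1.1)) := by
    rw [Matrix.mul_smul, Matrix.mul_assoc, Matrix.mul_assoc x.1.1,
      Matrix.nonsing_inv_mul_cancel_left _ _ hu]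
  rw [riemHess, covDeriv, christoffel_metric hx, riemGrad_eq B C hA hx]
  have h1 : fderiv ℝ (riemGrad (metric r m p) (J A B C)) x ξ = L ξ := by rw [hfd]
  rw [h1, hLξ, hg, hinv]
  simp only [ambient, Prod.fst_add, Prod.snd_add, Submodule.coe_add, Submodule.coe_neg, coe_symPart,
    add_zero]
  rw [sym_product_rule (transpose_coe_symMatrices _) (transpose_coe_symMatrices _)]
  simp only [solS, add_assoc]

end Hessian

end ModelReduction

namespace ModelReduction

/-! ### Matrix exponentials and positive definiteness. -/

section MatrixExponential

variable {r : ℕ}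

/-- The one-parameter group `t ↦ exp(t K)`. -/
noncomputable def expFlow (K : Matrix (Fin r) (Fin r) ℝ) (t : ℝ) : Matrix (Fin r) (Fin r) ℝ :=
  NormedSpace.exp (t • K)

@[simp] theorem expFlow_zero (K : Matrix (Fin r) (Fin r) ℝ) : expFlow K 0 = 1 := by
  simp [expFlow, NormedSpace.exp_zero]

theorem expFlow_neg_mul (K : Matrix (Fin r) (Fin r) ℝ) (t : ℝ) :
    expFlow (-K) t * expFlow K t = 1 := by
  rw [expFlow, expFlow, smul_neg, Matrix.exp_neg]
  exact Matrix.nonsing_inv_mul _ ((Matrix.isUnit_iff_isUnit_det _).1 (Matrix.isUnit_exp _))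

theorem commute_expFlow (K : Matrix (Fin r) (Fin r) ℝ) (t : ℝ) : Commute K (expFlow K t) :=
  (Commute.refl K).smul_right t |>.exp_right

/-- Halving the exponent writes the matrix as `Tᴴ T` with `T = exp(N/2) S` invertible. -/
theorem posDef_sqrt_mul_exp_mul_sqrt {S N : Matrix (Fin r) (Fin r) ℝ} (hS : S.IsHermitian)
    (hSu : IsUnit S) (hN : N.IsHermitian) : (S * NormedSpace.exp N * S).PosDef := by
  have hN' : ((1 / 2 : ℝ) • N).IsHermitian := by
    change ((1 / 2 : ℝ) • N)ᴴ = _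
    rw [Matrix.conjTranspose_smul, hN.eq]; simp
  have h1 : NormedSpace.exp N
      = NormedSpace.exp ((1 / 2 : ℝ) • N) * NormedSpace.exp ((1 / 2 : ℝ) • N) := by
    rw [← Matrix.exp_add_of_commute _ _ (Commute.refl _)]
    congr 1
    module
  have h2 : S * NormedSpace.exp N * S = (NormedSpace.exp ((1 / 2 : ℝ) • N) * S)ᴴ
      * (NormedSpace.exp ((1 / 2 : ℝ) • N) * S) := by
    rw [Matrix.conjTranspose_mul, hN'.exp.eq, hS.eq, h1]
    simp only [Matrix.mul_assoc]
  rw [h2]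
  exact Matrix.PosDef.conjTranspose_mul_self _
    (Matrix.mulVec_injective_of_isUnit ((Matrix.isUnit_exp _).mul hSu))

variable {A ξ : Matrix (Fin r) (Fin r) ℝ}

theorem sqrt_mul_sqrt_of_posDef (hA : A.PosDef) : CFC.sqrt A * CFC.sqrt A = A :=
  CFC.sqrt_mul_sqrt_self A hA.posSemidef.nonneg

theorem isUnit_sqrt_of_posDef (hA : A.PosDef) : IsUnit (CFC.sqrt A) := by
  have h := (Matrix.isUnit_iff_isUnit_det _).1 hA.isUnit
  rw [← sqrt_mul_sqrt_of_posDef hA, Matrix.det_mul] at h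
  exact (Matrix.isUnit_iff_isUnit_det _).2 (isUnit_of_mul_isUnit_left h)

theorem isHermitian_sqrt (A : Matrix (Fin r) (Fin r) ℝ) : (CFC.sqrt A).IsHermitian :=
  (Matrix.nonneg_iff_posSemidef.1 (CFC.sqrt_nonneg A)).isHermitian

/-- With `S = A^{1/2}`, the exponent is the conjugate of `t A⁻¹ ξ` by `S`, and `exp` commutes with
conjugation. The right-hand form is easy to differentiate; the left-hand one shows positivity. -/
theorem sqrt_mul_exp_mul_sqrt (hA : A.PosDef) (ξ : Matrix (Fin r) (Fin r) ℝ) (t : ℝ) :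
    CFC.sqrt A * NormedSpace.exp (t • ((CFC.sqrt A)⁻¹ * ξ * (CFC.sqrt A)⁻¹)) * CFC.sqrt A
      = A * expFlow (A⁻¹ * ξ) t := by
  have hu := isUnit_sqrt_of_posDef hA
  have hud := (Matrix.isUnit_iff_isUnit_det _).1 hu
  have hss := sqrt_mul_sqrt_of_posDef hA
  set S := CFC.sqrt A
  have h1 : t • (S⁻¹ * ξ * S⁻¹) = S * (t • (A⁻¹ * ξ)) * S⁻¹ := by
    rw [← hss, Matrix.mul_inv_rev, Matrix.mul_smul, Matrix.smul_mul, Matrix.mul_assoc S⁻¹ S⁻¹,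
      Matrix.mul_nonsing_inv_cancel_left _ _ hud]
  rw [h1, Matrix.exp_conj _ _ hu, Matrix.mul_assoc S, Matrix.nonsing_inv_mul_cancel_right _ _ hud,
    ← Matrix.mul_assoc, hss, expFlow]

theorem posDef_mul_expFlow (hA : A.PosDef) (hξ : ξᵀ = ξ) (t : ℝ) :
    (A * expFlow (A⁻¹ * ξ) t).PosDef := by
  rw [← sqrt_mul_exp_mul_sqrt hA]
  refine posDef_sqrt_mul_exp_mul_sqrt (isHermitian_sqrt A) (isUnit_sqrt_of_posDef hA) ?_
  have hS := (isHermitian_sqrt A).eq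
  rw [Matrix.conjTranspose_eq_transpose_of_trivial] at hS
  change (t • ((CFC.sqrt A)⁻¹ * ξ * (CFC.sqrt A)⁻¹))ᴴ = _
  rw [Matrix.conjTranspose_eq_transpose_of_trivial]
  simp [Matrix.transpose_nonsing_inv, hS, hξ, Matrix.mul_assoc]

theorem transpose_mul_expFlow (hA : A.PosDef) (hξ : ξᵀ = ξ) (t : ℝ) :
    (A * expFlow (A⁻¹ * ξ) t)ᵀ = A * expFlow (A⁻¹ * ξ) t := by
  simpa using (posDef_mul_expFlow hA hξ t).isHermitian.eq

/-- Since `(A⁻¹ ξ)ᵀ A = ξ = A (A⁻¹ ξ)` and `A⁻¹ ξ` commutes with its exponential, the velocity is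
symmetric, so the projection `symPart` leaves it unchanged. -/
theorem transpose_mul_expFlow_mul (hA : A.PosDef) (hξ : ξᵀ = ξ) (t : ℝ) :
    (A * expFlow (A⁻¹ * ξ) t * (A⁻¹ * ξ))ᵀ = A * expFlow (A⁻¹ * ξ) t * (A⁻¹ * ξ) := by
  have hud := (Matrix.isUnit_iff_isUnit_det _).1 hA.isUnit
  have hAt : Aᵀ = A := by simpa using hA.isHermitian.eq
  have h1 : (A⁻¹ * ξ)ᵀ * A = A * (A⁻¹ * ξ) := by
    rw [Matrix.transpose_mul, hξ, Matrix.transpose_nonsing_inv, hAt,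
      Matrix.nonsing_inv_mul_cancel_right _ _ hud, Matrix.mul_nonsing_inv_cancel_left _ _ hud]
  rw [Matrix.transpose_mul, transpose_mul_expFlow hA hξ, ← Matrix.mul_assoc, h1, Matrix.mul_assoc,
    (commute_expFlow (A⁻¹ * ξ) t).eq, Matrix.mul_assoc A (expFlow _ _)]

end MatrixExponential

end ModelReduction

namespace ModelReduction

attribute [local instance 2000] frobeniusTopology

/-! ### Geodesics and the exponential map. -/

section Geodesic

variable {r m p : ℕ}

theorem _root_.HasDerivAt.matrix_mul {k l q : ℕ} {t : ℝ} {f : ℝ → Matrix (Fin k) (Fin l) ℝ}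
    {g : ℝ → Matrix (Fin l) (Fin q) ℝ} {f' : Matrix (Fin k) (Fin l) ℝ}
    {g' : Matrix (Fin l) (Fin q) ℝ} (hf : HasDerivAt f f' t) (hg : HasDerivAt g g' t) :
    HasDerivAt (fun u => f u * g u) (f' * g t + f t * g') t := by
  have h := (isBoundedBilinearMap_matrix_mul.hasFDerivAt (f t, g t)).comp_hasDerivAt t
    (hf.prodMk hg)
  simpa [add_comm, Function.comp_def] using h

theorem _root_.HasDerivAt.matrix_inv {k : ℕ} {t : ℝ} {f : ℝ → Matrix (Fin k) (Fin k) ℝ}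
    {f' : Matrix (Fin k) (Fin k) ℝ} (hf : HasDerivAt f f' t) (hu : IsUnit (f t)) :
    HasDerivAt (fun u => (f u)⁻¹) (-((f t)⁻¹ * f' * (f t)⁻¹)) t := by
  have hd : DifferentiableAt ℝ (fun u => (f u)⁻¹) t := by
    have h1 : ContDiffAt ℝ 1 (fun Z : Matrix (Fin k) (Fin k) ℝ => Z⁻¹) (f t) :=
      ContDiffAt.matrix_inv contDiffAt_id hu
    exact (h1.differentiableAt one_ne_zero).comp t hf.differentiableAt
  have h := hd.hasDerivAt
  rwa [← fderiv_apply_one_eq_deriv, fderiv_matrix_inv hf.differentiableAt hu,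
    fderiv_apply_one_eq_deriv, hf.deriv] at h

theorem hasDerivAt_expFlow (K : Matrix (Fin r) (Fin r) ℝ) (t : ℝ) :
    HasDerivAt (expFlow K) (expFlow K t * K) t :=
  hasDerivAt_exp_smul_const K t

theorem eq_of_hasDerivAt_zero {F : Type*} [NormedAddCommGroup F] [NormedSpace ℝ F] {f : ℝ → F}
    {s : Set ℝ} (hs : IsOpen s) (hc : s.OrdConnected) (hf : ∀ t ∈ s, HasDerivAt f 0 t) {t u : ℝ}
    (ht : t ∈ s) (hu : u ∈ s) : f t = f u :=
  hs.is_const_of_deriv_eq_zero hc.isPreconnected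
    (fun v hv => (hf v hv).differentiableAt.differentiableWithinAt) (fun v hv => (hf v hv).deriv)
    ht hu

/-- The geodesic that starts at `x` with velocity `ξ`. -/
noncomputable def geodesic (x ξ : Space r m p) (t : ℝ) : Space r m p :=
  (symPart r (x.1.1 * expFlow (x.1.1⁻¹ * ξ.1.1) t), x.2.1 + t • ξ.2.1, x.2.2 + t • ξ.2.2)

variable {x ξ : Space r m p}

/-- The matrix is already symmetric at points of `M`; `symPart` in `geodesic` only supplies the
subtype. -/
theorem coe_geodesic_fst (hx : x ∈ M r m p) (t : ℝ) :
    (geodesic x ξ t).1.1 = x.1.1 * expFlow (x.1.1⁻¹ * ξ.1.1) t :=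
  sym_eq_self (transpose_mul_expFlow hx (transpose_coe_symMatrices _) t)

theorem geodesic_mem (hx : x ∈ M r m p) (t : ℝ) : geodesic x ξ t ∈ M r m p := by
  change ((geodesic x ξ t).1.1).PosDef
  rw [coe_geodesic_fst hx]
  exact posDef_mul_expFlow hx (transpose_coe_symMatrices _) t

theorem geodesic_zero (hx : x ∈ M r m p) : geodesic x ξ 0 = x := by
  refine ext_ambient ?_
  rw [ambient, coe_geodesic_fst hx]
  simp [geodesic, ambient]

theorem hasDerivAt_geodesic (x ξ : Space r m p) (t : ℝ) :
    HasDerivAt (geodesic x ξ)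
      (symPart r (x.1.1 * expFlow (x.1.1⁻¹ * ξ.1.1) t * (x.1.1⁻¹ * ξ.1.1)), ξ.2.1, ξ.2.2) t := by
  have h1 := (hasDerivAt_const t x.1.1).matrix_mul (hasDerivAt_expFlow (x.1.1⁻¹ * ξ.1.1) t)
  rw [Matrix.zero_mul, zero_add, ← Matrix.mul_assoc] at h1
  have h2 : HasDerivAt (fun u : ℝ => x.2.1 + u • ξ.2.1) ξ.2.1 t := by
    simpa using ((hasDerivAt_id t).smul_const ξ.2.1).const_add x.2.1
  have h3 : HasDerivAt (fun u : ℝ => x.2.2 + u • ξ.2.2) ξ.2.2 t := by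
    simpa using ((hasDerivAt_id t).smul_const ξ.2.2).const_add x.2.2
  exact ((symPart r).hasFDerivAt.comp_hasDerivAt t h1).prodMk (h2.prodMk h3)

theorem deriv_geodesic (x ξ : Space r m p) :
    deriv (geodesic x ξ) = fun t =>
      (symPart r (x.1.1 * expFlow (x.1.1⁻¹ * ξ.1.1) t * (x.1.1⁻¹ * ξ.1.1)), ξ.2.1, ξ.2.2) :=
  funext fun t => (hasDerivAt_geodesic x ξ t).deriv

theorem deriv_geodesic_zero (hx : x ∈ M r m p) : deriv (geodesic x ξ) 0 = ξ := by
  have hu : IsUnit x.1.1.det := (Matrix.isUnit_iff_isUnit_det _).1 (isUnit_of_mem hx)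
  rw [deriv_geodesic]
  refine Prod.ext (Subtype.ext ?_) rfl
  rw [coe_symPart, expFlow_zero, Matrix.mul_one, Matrix.mul_nonsing_inv_cancel_left _ _ hu,
    sym_eq_self (transpose_coe_symMatrices _)]

theorem hasDerivAt_mul_expFlow_mul (F K : Matrix (Fin r) (Fin r) ℝ) (t : ℝ) :
    HasDerivAt (fun u => F * expFlow K u * K) (F * expFlow K t * K * K) t := by
  refine (((hasDerivAt_const t F).matrix_mul (hasDerivAt_expFlow K t)).matrix_mul
    (hasDerivAt_const t K)).congr_deriv ?_
  rw [Matrix.zero_mul, zero_add, Matrix.mul_zero, add_zero, ← Matrix.mul_assoc]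

theorem hasDerivAt_deriv_geodesic (x ξ : Space r m p) (t : ℝ) :
    HasDerivAt (deriv (geodesic x ξ)) (symPart r (x.1.1 * expFlow (x.1.1⁻¹ * ξ.1.1) t
      * (x.1.1⁻¹ * ξ.1.1) * (x.1.1⁻¹ * ξ.1.1)), 0, 0) t := by
  have h1 := (symPart r).hasFDerivAt.comp_hasDerivAt t
    (hasDerivAt_mul_expFlow_mul x.1.1 (x.1.1⁻¹ * ξ.1.1) t)
  have h2 := hasDerivAt_const t ξ.2.1
  have h3 := hasDerivAt_const t ξ.2.2
  rw [deriv_geodesic]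
  exact h1.prodMk (h2.prodMk h3)

/-- With position `F` and velocity `F K`, the quadratic term is `(F K) F⁻¹ (F K) = F K K`, which is
the acceleration of `F = A exp(tK)`. -/
theorem christoffel_geodesic (hx : x ∈ M r m p) (t : ℝ) :
    -christoffel (metric r m p) (geodesic x ξ t) (deriv (geodesic x ξ) t) (deriv (geodesic x ξ) t)
      = (symPart r (x.1.1 * expFlow (x.1.1⁻¹ * ξ.1.1) t
          * (x.1.1⁻¹ * ξ.1.1) * (x.1.1⁻¹ * ξ.1.1)), 0, 0) := by
  have hG : (x.1.1 * expFlow (x.1.1⁻¹ * ξ.1.1) t).PosDef :=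
    posDef_mul_expFlow hx (transpose_coe_symMatrices _) t
  have hu := (Matrix.isUnit_iff_isUnit_det _).1 hG.isUnit
  have h0 := sym_eq_self (transpose_mul_expFlow_mul hx (transpose_coe_symMatrices ξ.1) t)
  rw [christoffel_metric (geodesic_mem hx t), deriv_geodesic, coe_geodesic_fst hx, coe_symPart, h0]
  generalize x.1.1⁻¹ * ξ.1.1 = K at *
  generalize x.1.1 * expFlow K t = F at *
  rw [Matrix.mul_assoc _ F⁻¹, ← Matrix.mul_assoc F⁻¹, Matrix.nonsing_inv_mul _ hu, Matrix.one_mul,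
    Prod.neg_mk, Prod.neg_mk, neg_neg, neg_zero, neg_zero]

theorem isGeodesicOn_geodesic (hx : x ∈ M r m p) :
    IsGeodesicOn (metric r m p) (M r m p) (geodesic x ξ) univ := by
  refine fun t _ => ⟨geodesic_mem hx t, (hasDerivAt_geodesic x ξ t).differentiableAt, ?_⟩
  rw [christoffel_geodesic hx]
  exact hasDerivAt_deriv_geodesic x ξ t

/-- Uniqueness through conserved quantities on an interval: `K = A_r⁻¹ A_r'` is constant, then so is
`A_r exp(-tK)`. The other two components have constant velocity. -/
theorem IsGeodesicOn.ambient_eq {γ : ℝ → Space r m p} {s : Set ℝ} (hs : IsOpen s)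
    (hc : s.OrdConnected) (hγ : IsGeodesicOn (metric r m p) (M r m p) γ s) (h0 : (0 : ℝ) ∈ s)
    {t : ℝ} (ht : t ∈ s) :
    ambient (γ t) = ((γ 0).1.1 * expFlow ((γ 0).1.1⁻¹ * (deriv γ 0).1.1) t,
      (γ 0).2.1 + t • (deriv γ 0).2.1, (γ 0).2.2 + t • (deriv γ 0).2.2) := by
  have hd : ∀ u ∈ s, HasDerivAt γ (deriv γ u) u := fun u hu => (hγ u hu).2.1.hasDerivAt
  have hdd : ∀ u ∈ s, HasDerivAt (deriv γ)
      (symPart r ((deriv γ u).1.1 * (γ u).1.1⁻¹ * (deriv γ u).1.1), 0, 0) u := by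
    intro u hu
    have h := (hγ u hu).2.2
    rw [christoffel_metric (hγ u hu).1] at h
    simpa using h
  have hA : ∀ u ∈ s, HasDerivAt (fun u => (γ u).1.1) (deriv γ u).1.1 u := fun u hu =>
    (coordA r m p).hasFDerivAt.comp_hasDerivAt u (hd u hu)
  have hB : ∀ u ∈ s, HasDerivAt (fun u => (γ u).2.1) (deriv γ u).2.1 u := fun u hu =>
    (coordB r m p).hasFDerivAt.comp_hasDerivAt u (hd u hu)
  have hC : ∀ u ∈ s, HasDerivAt (fun u => (γ u).2.2) (deriv γ u).2.2 u := fun u hu =>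
    (coordC r m p).hasFDerivAt.comp_hasDerivAt u (hd u hu)
  have hA' : ∀ u ∈ s, HasDerivAt (fun u => (deriv γ u).1.1)
      ((deriv γ u).1.1 * (γ u).1.1⁻¹ * (deriv γ u).1.1) u := fun u hu => by
    have h : HasDerivAt (fun u => (deriv γ u).1.1)
        (sym ((deriv γ u).1.1 * (γ u).1.1⁻¹ * (deriv γ u).1.1)) u :=
      (coordA r m p).hasFDerivAt.comp_hasDerivAt u (hdd u hu)
    rwa [sym_eq_self] at h
    simp [Matrix.transpose_nonsing_inv, Matrix.mul_assoc]
  have hB' : ∀ u ∈ s, HasDerivAt (fun u => (deriv γ u).2.1) 0 u := fun u hu =>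
    (coordB r m p).hasFDerivAt.comp_hasDerivAt u (hdd u hu)
  have hC' : ∀ u ∈ s, HasDerivAt (fun u => (deriv γ u).2.2) 0 u := fun u hu =>
    (coordC r m p).hasFDerivAt.comp_hasDerivAt u (hdd u hu)
  set K := (γ 0).1.1⁻¹ * (deriv γ 0).1.1 with hK
  have hKu : ∀ u ∈ s, (γ u).1.1⁻¹ * (deriv γ u).1.1 = K := fun u hu => by
    refine eq_of_hasDerivAt_zero hs hc
      (f := fun u => (γ u).1.1⁻¹ * (deriv γ u).1.1) (fun v hv => ?_) hu h0
    -- The two terms of the product rule, `-A_r⁻¹ A_r' A_r⁻¹ A_r'` and `A_r⁻¹ (A_r' A_r⁻¹ A_r')`,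
    -- cancel.
    have h := ((hA v hv).matrix_inv (isUnit_of_mem (hγ v hv).1)).matrix_mul (hA' v hv)
    refine h.congr_deriv ?_
    simp only [Matrix.mul_assoc, Matrix.neg_mul, neg_add_cancel]
  have hAK : ∀ u ∈ s, (deriv γ u).1.1 = (γ u).1.1 * K := fun u hu => by
    rw [← hKu u hu, Matrix.mul_nonsing_inv_cancel_left _ _
      ((Matrix.isUnit_iff_isUnit_det _).1 (isUnit_of_mem (hγ u hu).1))]
  have hconst : ∀ u ∈ s, (γ u).1.1 * expFlow (-K) u = (γ 0).1.1 := fun u hu => by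
    have h := eq_of_hasDerivAt_zero hs hc
      (f := fun u => (γ u).1.1 * expFlow (-K) u) (fun v hv => ?_) hu h0
    · simpa using h
    have h := (hA v hv).matrix_mul (hasDerivAt_expFlow (-K) v)
    refine h.congr_deriv ?_
    rw [hAK v hv, ← (commute_expFlow (-K) v).eq]
    simp [Matrix.mul_assoc]
  have hline : ∀ {k l : ℕ} {f f' : ℝ → Matrix (Fin k) (Fin l) ℝ}, (∀ u ∈ s, HasDerivAt f (f' u) u) →
      (∀ u ∈ s, HasDerivAt f' 0 u) → f t = f 0 + t • f' 0 := by
    intro k l f f' hf hf'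
    have h := eq_of_hasDerivAt_zero hs hc (f := fun u => f u - u • f' 0) (fun v hv => ?_) ht h0
    · simp only [zero_smul, sub_zero] at h
      rw [← h]; abel
    have h := (hf v hv).sub ((hasDerivAt_id v).smul_const (f' 0))
    rw [eq_of_hasDerivAt_zero hs hc hf' hv h0, one_smul, sub_self] at h
    exact h
  refine Prod.ext ?_ (Prod.ext (hline hB hB') (hline hC hC'))
  change (γ t).1.1 = _
  rw [← hconst t ht, Matrix.mul_assoc, expFlow_neg_mul, Matrix.mul_one]

theorem ambient_geodesic (hx : x ∈ M r m p) (t : ℝ) :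
    ambient (geodesic x ξ t) = (x.1.1 * expFlow (x.1.1⁻¹ * ξ.1.1) t, x.2.1 + t • ξ.2.1,
      x.2.2 + t • ξ.2.2) := by
  rw [ambient, coe_geodesic_fst hx, geodesic]

theorem isRiemExp_geodesic (hx : x ∈ M r m p) :
    IsRiemExp (metric r m p) (M r m p) x ξ (geodesic x ξ 1) :=
  ⟨univ, isOpen_univ, ordConnected_univ, mem_univ _, mem_univ _, geodesic x ξ,
    isGeodesicOn_geodesic hx, geodesic_zero hx, deriv_geodesic_zero hx, rfl⟩

/-- Every admissible geodesic is determined on its whole interval by its initial data, so the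
endpoint depends neither on the interval nor on the curve. -/
theorem isRiemExp_iff (hx : x ∈ M r m p) (y : Space r m p) :
    IsRiemExp (metric r m p) (M r m p) x ξ y ↔
      ambient y = (x.1.1 * expFlow (x.1.1⁻¹ * ξ.1.1) 1, x.2.1 + ξ.2.1, x.2.2 + ξ.2.2) := by
  constructor
  · rintro ⟨s, hs, hc, h0, h1, γ, hγ, rfl, rfl, rfl⟩
    have h := hγ.ambient_eq hs hc h0 h1
    rwa [one_smul, one_smul] at h
  · intro h
    have : y = geodesic x ξ 1 := ext_ambient (by
      rw [h, ambient_geodesic hx, one_smul, one_smul])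
    exact this ▸ isRiemExp_geodesic hx

end Geodesic

end ModelReduction

theorem mainTheorem2 (n m p r : ℕ)
    (A : Matrix (Fin n) (Fin n) ℝ) (hA : A.PosDef)
    (B : Matrix (Fin n) (Fin m) ℝ) (C : Matrix (Fin p) (Fin n) ℝ) :
    -- `M` is an open subset of `Sym(r) × ℝ^{r×m} × ℝ^{p×r}` with a Riemannian metric,
    -- and `J` is finite and smooth on it
    IsOpen (ModelReduction.M r m p) ∧
    ModelReduction.IsRiemannianMetricOn (ModelReduction.metric r m p) (ModelReduction.M r m p) ∧
    (∀ x ∈ ModelReduction.M r m p,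
      Integrable (ModelReduction.powerSpectrum (ModelReduction.errorTransfer A B C x))) ∧
    ContDiffOn ℝ ∞ (ModelReduction.J A B C) (ModelReduction.M r m p) ∧
    (∀ x ∈ ModelReduction.M r m p,
      ∀ (Ar : Matrix (Fin r) (Fin r) ℝ) (Br : Matrix (Fin r) (Fin m) ℝ)
        (Cr : Matrix (Fin p) (Fin r) ℝ), ModelReduction.ambient x = (Ar, Br, Cr) →
      -- the gradient and the Hessian
      ∃ (P Q : Matrix (Fin r) (Fin r) ℝ) (X Y : Matrix (Fin n) (Fin r) ℝ),
        (∀ P₁ Q₁ X₁ Y₁, ModelReduction.SolvesSylvester A B C Ar Br Cr P₁ Q₁ X₁ Y₁ ↔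
          P₁ = P ∧ Q₁ = Q ∧ X₁ = X ∧ Y₁ = Y) ∧
        ModelReduction.ambient
            (ModelReduction.riemGrad (ModelReduction.metric r m p) (ModelReduction.J A B C) x) =
          (-(2 : ℝ) • (Ar * ModelReduction.sym (Q * P + Yᵀ * X) * Ar),
            (2 : ℝ) • (Q * Br + Yᵀ * B),
            (2 : ℝ) • (Cr * P - C * X)) ∧
        DifferentiableAt ℝ
          (ModelReduction.riemGrad (ModelReduction.metric r m p) (ModelReduction.J A B C)) x ∧
        ∀ (ξ : ModelReduction.Space r m p)
          (Ar' : Matrix (Fin r) (Fin r) ℝ) (Br' : Matrix (Fin r) (Fin m) ℝ)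
          (Cr' : Matrix (Fin p) (Fin r) ℝ), ModelReduction.ambient ξ = (Ar', Br', Cr') →
          ∃ (P' Q' : Matrix (Fin r) (Fin r) ℝ) (X' Y' : Matrix (Fin n) (Fin r) ℝ),
            (∀ P₁ Q₁ X₁ Y₁,
              ModelReduction.SolvesDiffSylvester A B C Ar Br Cr Ar' Br' Cr' P Q X Y P₁ Q₁ X₁ Y₁ ↔
                P₁ = P' ∧ Q₁ = Q' ∧ X₁ = X' ∧ Y₁ = Y') ∧
            ModelReduction.ambient
                (ModelReduction.riemHess (ModelReduction.metric r m p)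
                  (ModelReduction.J A B C) x ξ) =
              (-(2 : ℝ) • (Ar * ModelReduction.sym (Q' * P + Q * P' + Y'ᵀ * X + Yᵀ * X') * Ar)
                  - (2 : ℝ) • ModelReduction.sym
                      (Ar' * ModelReduction.sym (Q * P + Yᵀ * X) * Ar),
                (2 : ℝ) • (Q' * Br + Q * Br' + Y'ᵀ * B),
                (2 : ℝ) • (Cr' * P + Cr * P' - C * X'))) ∧
    -- the geodesics and the exponential map
    (∀ x ∈ ModelReduction.M r m p, ∀ ξ : ModelReduction.Space r m p,
      (∃ γ : ℝ → ModelReduction.Space r m p,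
        ModelReduction.IsGeodesicOn (ModelReduction.metric r m p) (ModelReduction.M r m p) γ univ ∧
        γ 0 = x ∧ deriv γ 0 = ξ ∧
        ∀ t : ℝ, ModelReduction.ambient (γ t) =
          (CFC.sqrt x.1.1 * NormedSpace.exp (t • ((CFC.sqrt x.1.1)⁻¹ * ξ.1.1 * (CFC.sqrt x.1.1)⁻¹))
              * CFC.sqrt x.1.1,
            x.2.1 + t • ξ.2.1,
            x.2.2 + t • ξ.2.2)) ∧
      ∀ y : ModelReduction.Space r m p,
        ModelReduction.IsRiemExp (ModelReduction.metric r m p) (ModelReduction.M r m p) x ξ y ↔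
          ModelReduction.ambient y =
            (CFC.sqrt x.1.1 * NormedSpace.exp ((CFC.sqrt x.1.1)⁻¹ * ξ.1.1 * (CFC.sqrt x.1.1)⁻¹)
                * CFC.sqrt x.1.1,
              x.2.1 + ξ.2.1,
              x.2.2 + ξ.2.2)) ∧
    ModelReduction.GeodesicallyComplete (ModelReduction.metric r m p)
      (ModelReduction.M r m p) := by
  refine ⟨ModelReduction.isOpen_M r m p, ModelReduction.isRiemannianMetricOn_metric r m p,
    fun x hx => ModelReduction.integrable_powerSpectrum_errorTransfer hA B C hx,
    fun x hx => (ModelReduction.contDiffAt_J B C hA hx).contDiffWithinAt, ?_, ?_,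
    fun x hx ξ => ⟨_, ModelReduction.isRiemExp_geodesic hx⟩⟩
  · rintro x hx Ar Br Cr h
    simp only [ModelReduction.ambient, Prod.mk.injEq] at h
    obtain ⟨rfl, rfl, rfl⟩ := h
    refine ⟨_, _, _, _, ModelReduction.solvesSylvester_iff B C hA hx, ?_,
      ModelReduction.differentiableAt_riemGrad B C hA hx, ?_⟩
    · rw [ModelReduction.riemGrad_eq B C hA hx, ModelReduction.ambient_gradField]
      rfl
    · rintro ξ Ar' Br' Cr' h
      simp only [ModelReduction.ambient, Prod.mk.injEq] at h
      obtain ⟨rfl, rfl, rfl⟩ := h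
      exact ⟨_, _, _, _, ModelReduction.solvesDiffSylvester_iff hA hx ξ,
        ModelReduction.ambient_riemHess B C hA hx ξ⟩
  · refine fun x hx ξ => ⟨⟨ModelReduction.geodesic x ξ, ModelReduction.isGeodesicOn_geodesic hx,
      ModelReduction.geodesic_zero hx, ModelReduction.deriv_geodesic_zero hx, fun t => ?_⟩,
      fun y => ?_⟩
    · rw [ModelReduction.ambient_geodesic hx, ModelReduction.sqrt_mul_exp_mul_sqrt hx]
    · rw [ModelReduction.isRiemExp_iff hx, ← ModelReduction.sqrt_mul_exp_mul_sqrt hx, one_smul]
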